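/- Let $d\in\mathbb N$, $T>0$, and let $\varsigma:[0,T]\to(0,\infty)$ be a (measurable) noise schedule with $\int_0^T\varsigma_s^2\,ds<\infty$; put $\beta_t=\int_0^t\varsigma_s^2\,ds$. Let $\Pi^*$ be a probability distribution on $\mathbb R^d$ that is not a point mass, and let $v_0\in[0,+\infty]$. For $x\in\mathbb R^d$ let $\mathbb Q^x$ be the law, on continuous trajectories $[0,T]\to\mathbb R^d$, of the (weak) solution of the Brownian-bridge dynamics $$ dZ_t=\varsigma_t^2\,\frac{x-Z_t}{\beta_T-\beta_t}\,dt+\varsigma_t\,dW_t,\qquad t\in[0,T), $$ with $Z_T=\lim_{t\uparrow T}Z_t$, initialized from $Z_0\sim\mathcal N(0,v_0 I)$ if $v_0<+\infty$ (so $Z_0=0$ if $v_0=0$), where $v_0=+\infty$ stands for the initialization $Z_0\sim\mathcal N(x,\beta_T I)$, i.e. the conditional law of $Z_0$ given $Z_T=x$ for the driftless process $dZ_t=\varsigma_t\,dW_t$ started from the improper uniform distribution on $\mathbb R^d$. Let $\mathbb Q^{\Pi^*}=\int\mathbb Q^x\,\Pi^*(dx)$ be the mixture of these path measures. Then $\mathbb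 Q^{\Pi^*}$ is Markov if and only if $v_0=0$ or $v_0=+\infty$. -/

import Mathlib

open MeasureTheory ProbabilityTheory
open scoped NNReal ENNReal

namespace BridgeMixture

noncomputable section

/-- The state space `ℝ^d` with the Euclidean norm. -/
abbrev State (d : ℕ) : Type := EuclideanSpace ℝ (Fin d)

/-- The space of continuous trajectories `[0, T] → ℝ^d`. -/
abbrev Traj (d : ℕ) (T : ℝ≥0) : Type := C(Set.Icc (0 : ℝ) T, State d)

/-- The `σ`-algebra on continuous trajectories generated by the coordinate maps `z ↦ z t`. -/
instance instMeasurableSpaceTraj (d : ℕ) (T : ℝ≥0) : MeasurableSpace (Traj d T) :=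
  MeasurableSpace.comap (fun z : Traj d T => (z : Set.Icc (0 : ℝ) T → State d)) MeasurableSpace.pi

/-- The position `z_t` of a trajectory `z` at a time `t ∈ [0, T]`
(extended by constants to the times outside `[0, T]`, which are not used). -/
def pos {d : ℕ} {T : ℝ≥0} (t : ℝ) (z : Traj d T) : State d :=
  Set.IccExtend T.2 (z : Set.Icc (0 : ℝ) T → State d) t

lemma measurable_pos {d : ℕ} {T : ℝ≥0} (t : ℝ) :
    Measurable (pos t : Traj d T → State d) :=
  (measurable_pi_apply (Set.projIcc 0 (T : ℝ) T.2 t)).comp (comap_measurable _)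

/-- The isotropic normal distribution `N(m, v I)` on `ℝ^d` (for `v ≥ 0`; `v = 0` is the Dirac
mass at `m`). -/
def isoGaussian {d : ℕ} (m : State d) (v : ℝ) : Measure (State d) :=
  multivariateGaussian m (v • (1 : Matrix (Fin d) (Fin d) ℝ))

/-- `W` is, on `[0, T]`, a standard `d`-dimensional Brownian motion relative to the
filtration `𝓕`. -/
structure IsBrownianMotion {d : ℕ} {Ω : Type} {mΩ : MeasurableSpace Ω} (P : Measure Ω)
    (𝓕 : Filtration ℝ mΩ) (T : ℝ≥0) (W : ℝ → Ω → State d) : Prop where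
  adapted : ∀ t ∈ Set.Icc (0 : ℝ) T, Measurable[𝓕 t] (W t)
  zero : ∀ᵐ ω ∂P, W 0 ω = 0
  continuousOn : ∀ᵐ ω ∂P, ContinuousOn (fun t => W t ω) (Set.Icc (0 : ℝ) T)
  hasLaw_increment : ∀ s t : ℝ, 0 ≤ s → s ≤ t → t ≤ T →
    HasLaw (fun ω => W t ω - W s ω) (isoGaussian 0 (t - s)) P
  indep_increment : ∀ s t : ℝ, 0 ≤ s → s ≤ t → t ≤ T →
    Indep (MeasurableSpace.comap (fun ω => W t ω - W s ω) inferInstance) (𝓕 s) P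

/-- The step function `∑_{i < n} c_i 1_{(τ_i, τ_{i+1}]}`. -/
def stepFun (n : ℕ) (τ c : ℕ → ℝ) (s : ℝ) : ℝ :=
  ∑ i ∈ Finset.range n, (Set.Ioc (τ i) (τ (i + 1))).indicator (fun _ => c i) s

/-- The stochastic integral `∑_{i < n} c_i (W_{τ_{i+1}} - W_{τ_i})` of a step function. -/
def stepIntegral {d : ℕ} {Ω : Type} (W : ℝ → Ω → State d) (n : ℕ) (τ c : ℕ → ℝ) (ω : Ω) :
    State d :=
  ∑ i ∈ Finset.range n, c i • (W (τ (i + 1)) ω - W (τ i) ω)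

/-- The random variable `J` is (almost surely) the stochastic integral `∫_0^t f_s dW_s` of the
deterministic integrand `f ∈ L²(0, t)`: it is the `L²(P)`-limit of the integrals of step functions
that converge to `f` in `L²(0, t)`. -/
def IsStochasticIntegral {d : ℕ} {Ω : Type} {mΩ : MeasurableSpace Ω} (P : Measure Ω)
    (W : ℝ → Ω → State d) (f : ℝ → ℝ) (t : ℝ) (J : Ω → State d) : Prop :=
  ∀ ε : ℝ≥0∞, 0 < ε → ∃ (n : ℕ) (τ c : ℕ → ℝ), Monotone τ ∧ τ 0 = 0 ∧ τ n = t ∧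
    ∫⁻ s in Set.Ioc 0 t, ‖f s - stepFun n τ c s‖ₑ ^ 2 < ε ∧
    ∫⁻ ω, ‖J ω - stepIntegral W n τ c ω‖ₑ ^ 2 ∂P < ε

/-- `β_t = ∫_0^t ς_s² ds`. -/
def accVar (ς : ℝ → ℝ) (t : ℝ) : ℝ := ∫ s in (0 : ℝ)..t, ς s ^ 2

/-- The Brownian-bridge drift `ς_t² (x - z) / (β_T - β_t)`. -/
def bridgeDrift {d : ℕ} (ς : ℝ → ℝ) (T : ℝ≥0) (x z : State d) (t : ℝ) : State d :=
  (ς t ^ 2 / (accVar ς T - accVar ς t)) • (x - z)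

/-- `(Ω, P, 𝓕, W, Z)` is a weak solution of
`dZ_t = ς_t² (x - Z_t) / (β_T - β_t) dt + ς_t dW_t`, `Z_0 ∼ μ₀`, with trajectories that are
continuous on the closed interval `[0, T]`; as the drift is singular at `T`, the integrated
equation is required at all times `t < T`, and `Z_T` is the limit. -/
structure IsBridgeSolution {d : ℕ} (ς : ℝ → ℝ) (T : ℝ≥0) (x : State d) (μ₀ : Measure (State d))
    {Ω : Type} {mΩ : MeasurableSpace Ω} (P : Measure Ω) (𝓕 : Filtration ℝ mΩ)
    (W : ℝ → Ω → State d) (Z : Ω → Traj d T) : Prop where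
  brownian : IsBrownianMotion P 𝓕 T W
  adapted : ∀ t ∈ Set.Icc (0 : ℝ) T, Measurable[𝓕 t] (fun ω => pos t (Z ω))
  init : HasLaw (fun ω => pos 0 (Z ω)) μ₀ P
  sde : ∀ t ∈ Set.Ico (0 : ℝ) T, IsStochasticIntegral P W ς t
    (fun ω => pos t (Z ω) - pos 0 (Z ω) - ∫ s in (0 : ℝ)..t, bridgeDrift ς T x (pos s (Z ω)) s)

/-- `Q` is the path measure of the bridge dynamics towards `x` started from `μ₀`. -/
def IsBridgeLaw {d : ℕ} (ς : ℝ → ℝ) (T : ℝ≥0) (x : State d) (μ₀ : Measure (State d))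
    (Q : Measure (Traj d T)) : Prop :=
  ∃ (Ω : Type) (mΩ : MeasurableSpace Ω) (P : Measure Ω) (𝓕 : Filtration ℝ mΩ)
    (W : ℝ → Ω → State d) (Z : Ω → Traj d T), IsProbabilityMeasure P ∧
    IsBridgeSolution ς T x μ₀ P 𝓕 W Z ∧ HasLaw Z Q P

/-- The initial distribution with variance parameter `v₀ ∈ [0, +∞]`. For finite `v₀` it is
`N(0, v₀ I)`, independently of the end point `x`. The value `v₀ = +∞` stands for the improper
uniform initialization `dz` of the driftless process `dZ_t = ς_t dW_t`, which, conditioned on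
`Z_T = x`, has the initial distribution `N(x, β_T I)`. -/
def initialLaw {d : ℕ} (ς : ℝ → ℝ) (T : ℝ≥0) (v₀ : ℝ≥0∞) (x : State d) : Measure (State d) :=
  if v₀ = ∞ then isoGaussian x (accVar ς T) else isoGaussian 0 v₀.toReal

/-- The `σ`-algebra `σ(Z_u : 0 ≤ u ≤ s)` of the past on the path space. -/
abbrev past (d : ℕ) (T : ℝ≥0) (s : ℝ) : MeasurableSpace (Traj d T) :=
  ⨆ u ∈ Set.Icc (0 : ℝ) s, MeasurableSpace.comap (pos u) inferInstance

/-- The `σ`-algebra `σ(Z_s)` of the present on the path space. -/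
abbrev present (d : ℕ) (T : ℝ≥0) (s : ℝ) : MeasurableSpace (Traj d T) :=
  MeasurableSpace.comap (pos s) inferInstance

lemma past_le (d : ℕ) (T : ℝ≥0) (s : ℝ) : past d T s ≤ instMeasurableSpaceTraj d T :=
  iSup₂_le fun u _ => (measurable_pos u).comap_le

lemma present_le (d : ℕ) (T : ℝ≥0) (s : ℝ) : present d T s ≤ instMeasurableSpaceTraj d T :=
  (measurable_pos s).comap_le

/-- The path measure `Q` is Markov: for `0 ≤ s ≤ t ≤ T` and Borel `B`,
`Q(Z_t ∈ B | Z_u, 0 ≤ u ≤ s) = Q(Z_t ∈ B | Z_s)` almost surely. -/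
def IsMarkov {d : ℕ} {T : ℝ≥0} (Q : Measure (Traj d T)) : Prop :=
  ∀ s t : ℝ, 0 ≤ s → s ≤ t → t ≤ T → ∀ B : Set (State d), MeasurableSet B →
    Q⟦pos t ⁻¹' B|past d T s⟧ =ᵐ[Q] Q⟦pos t ⁻¹' B|present d T s⟧

end

end BridgeMixture

open BridgeMixture

/-! Write r_t = β_T - β_t. Along the bridge towards x, integration by parts removes the drift from
G_t = (Z_t - x)/r_t: dG_t = (ς_t/r_t) dW_t, so G has independent Gaussian increments in the clock
1/r_t (`IsBridgeSolution.hasGaussianIncrements_scaledGap`). Together with the law of Z_0, this is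
all that is needed about the bridge; it even forces Z_T = x (`ae_terminal`).

For any κ put τ_t = 1/r_t - κ and B_t = G_t + κ x, so that Z_t/r_t = B_t + τ_t x. If B_0 ∼ N(0, τ_0
I) for every x, then Z_t/r_t is a Brownian motion in the clock τ with an unknown drift x, and its
current value is a sufficient statistic for the drift: the residuals B_u - (τ_u/τ_s) B_s, u ≤ s, can
be computed from the trajectory without knowing x and are independent of (Z_s, Z_t), so the past
adds nothing to Z_s (`exists_integral_innovation_mul`, `isMarkov_bind`). The case v₀ = 0 fits with κ
= 1/r_0, the case v₀ = ∞ with κ = 0.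

If 0 < v₀ < ∞, fix 0 < s < T and put c = r_s/r_0, W = c Z_0, R = Z_s - W. Then R is (1 - c) Z_T plus
Gaussian noise, and W is Gaussian and independent of (R, Z_T). The past contains both R and W, the
present only R + W. The Markov property makes the prediction f(R) of Z_T a function of R + W; as W
has a positive density, f is constant and R is independent of Z_T
(`indepFun_of_condExp_preimage_sup_eq`). Cancelling the nonvanishing characteristic function of the
noise shows that the characteristic function of Π* is multiplicative, so Π* is a point mass
(`exists_eq_dirac_of_integral_wave_add`).

Laws and independence are expressed throughout by characteristic functions, mostly tested against
bounded variables of the past; such identities pass to limits and to mixtures. -/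

namespace BridgeMixture

/-! ### Characteristic functions and Gaussian increments -/

open Filter Topology

variable {d : ℕ}

/-- The plane wave `v ↦ exp(i ⟨u, v⟩)`. -/
noncomputable def wave (u v : State d) : ℂ := Complex.exp ((inner ℝ u v : ℝ) * Complex.I)

/-- The characteristic function of `N(0, v I)` at the frequency `u`. -/
noncomputable def gaussChar (u : State d) (v : ℝ) : ℂ :=
  Complex.exp ((-(‖u‖ ^ 2 * v / 2) : ℝ) : ℂ)

lemma wave_add (u v w : State d) : wave u (v + w) = wave u v * wave u w := by
  simp [wave, inner_add_right, add_mul, Complex.exp_add]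

lemma wave_add_left (u u' v : State d) : wave (u + u') v = wave u v * wave u' v := by
  simp [wave, inner_add_left, add_mul, Complex.exp_add]

lemma wave_smul_right (u v : State d) (a : ℝ) : wave u (a • v) = wave (a • u) v := by
  simp [wave, inner_smul_left, inner_smul_right]

@[simp] lemma wave_zero_right (u : State d) : wave u 0 = 1 := by simp [wave]

@[simp] lemma wave_zero_left (u : State d) : wave 0 u = 1 := by simp [wave]

@[simp] lemma norm_wave (u v : State d) : ‖wave u v‖ = 1 := by
  simp [wave]

lemma continuous_wave (u : State d) : Continuous (wave u) := by
  unfold wave; fun_prop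

lemma measurable_wave (u : State d) : Measurable (wave u) := (continuous_wave u).measurable

lemma gaussChar_add (u : State d) (v w : ℝ) :
    gaussChar u (v + w) = gaussChar u v * gaussChar u w := by
  rw [gaussChar, gaussChar, gaussChar, ← Complex.exp_add]; push_cast; ring_nf

lemma gaussChar_smul (u : State d) (a v : ℝ) : gaussChar (a • u) v = gaussChar u (a ^ 2 * v) := by
  simp only [gaussChar, norm_smul, Real.norm_eq_abs, mul_pow, sq_abs]; ring_nf

@[simp] lemma gaussChar_zero_right (u : State d) : gaussChar u 0 = 1 := by simp [gaussChar]

@[simp] lemma gaussChar_zero_left (v : ℝ) : gaussChar (0 : State d) v = 1 := by simp [gaussChar]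

lemma gaussChar_ne_zero (u : State d) (v : ℝ) : gaussChar u v ≠ 0 := Complex.exp_ne_zero _

lemma continuous_gaussChar (u : State d) : Continuous (gaussChar u) := by
  unfold gaussChar; fun_prop

lemma posSemidef_smul_one {v : ℝ} (hv : 0 ≤ v) :
    (v • (1 : Matrix (Fin d) (Fin d) ℝ)).PosSemidef :=
  Matrix.PosSemidef.one.smul hv

instance isGaussian_isoGaussian (m : State d) (v : ℝ) : IsGaussian (isoGaussian m v) := by
  unfold isoGaussian; infer_instance

lemma charFun_isoGaussian (m : State d) {v : ℝ} (hv : 0 ≤ v) (u : State d) :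
    charFun (isoGaussian m v) u = wave u m * gaussChar u v := by
  rw [isoGaussian, charFun_multivariateGaussian (posSemidef_smul_one hv), wave, gaussChar,
    ← Complex.exp_add, EuclideanSpace.real_norm_sq_eq]
  congr 1
  simp [Matrix.smul_mulVec, dotProduct, pow_two]
  have hsum : ∑ i, (u i : ℂ) * (v * u i) = (∑ i, (u i : ℂ) * u i) * v := by
    rw [Finset.sum_mul]
    exact Finset.sum_congr rfl fun i _ => by ring
  rw [hsum]
  ring

lemma charFun_eq_integral_wave (μ : Measure (State d)) (u : State d) :
    charFun μ u = ∫ x, wave u x ∂μ := by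
  simp [charFun_apply, wave, real_inner_comm]

lemma integral_wave_isoGaussian (m : State d) {v : ℝ} (hv : 0 ≤ v) (u : State d) :
    ∫ x, wave u x ∂(isoGaussian m v) = wave u m * gaussChar u v := by
  rw [← charFun_eq_integral_wave, charFun_isoGaussian m hv]

lemma ext_of_integral_wave {μ ν : Measure (State d)} [IsFiniteMeasure μ] [IsFiniteMeasure ν]
    (h : ∀ u, ∫ x, wave u x ∂μ = ∫ x, wave u x ∂ν) : μ = ν := by
  refine Measure.ext_of_charFun (funext fun u => ?_)
  rw [charFun_eq_integral_wave, charFun_eq_integral_wave, h]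

variable {Ω : Type*} {mΩ : MeasurableSpace Ω} {P : Measure Ω} {𝓕 : Filtration ℝ mΩ}

/-- The process `K`, observed at the times of `S`, is adapted to `𝓕` and has increments
`K t - K s` that are independent of `𝓕 s` with law `N(0, (A t - A s) I)`. -/
structure HasGaussianIncrements (P : Measure Ω) (𝓕 : Filtration ℝ mΩ) (S : Set ℝ) (A : ℝ → ℝ)
    (K : ℝ → Ω → State d) : Prop where
  adapted : ∀ t ∈ S, Measurable[𝓕 t] (K t)
  integral_mul_wave : ∀ s ∈ S, ∀ t ∈ S, s ≤ t → ∀ Y : Ω → ℂ, Measurable[𝓕 s] Y →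
    (∀ ω, ‖Y ω‖ ≤ 1) → ∀ u : State d,
    ∫ ω, Y ω * wave u (K t ω - K s ω) ∂P = (∫ ω, Y ω ∂P) * gaussChar u (A t - A s)

lemma measurable_wave_comp {X : Ω → State d} (hX : Measurable X) (u : State d) :
    Measurable (fun ω => wave u (X ω)) := (measurable_wave u).comp hX

lemma IsBrownianMotion.hasGaussianIncrements {Ω : Type} {mΩ : MeasurableSpace Ω} {P : Measure Ω}
    {𝓕 : Filtration ℝ mΩ} {T : ℝ≥0} {W : ℝ → Ω → State d} (hW : IsBrownianMotion P 𝓕 T W) :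
    HasGaussianIncrements P 𝓕 (Set.Icc 0 (T : ℝ)) id W where
  adapted := hW.adapted
  integral_mul_wave s hs t ht hst Y hY _ u := by
    have hlaw := hW.hasLaw_increment s t hs.1 hst ht.2
    have hind : IndepFun Y (fun ω => W t ω - W s ω) P :=
      (indep_of_indep_of_le_right (hW.indep_increment s t hs.1 hst ht.2) hY.comap_le).symm
    have hY' : Measurable Y := hY.mono (𝓕.le s) le_rfl
    have := hind.integral_fun_comp_mul_comp (f := id) (g := wave u) hY'.aemeasurable
      hlaw.aemeasurable (by fun_prop) (continuous_wave u).aestronglyMeasurable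
    simp only [id] at this ⊢
    have hintegral : ∫ ω, wave u (W t ω - W s ω) ∂P = _ :=
      hlaw.integral_comp (f := wave u) (continuous_wave u).aestronglyMeasurable
    rw [this, hintegral, integral_wave_isoGaussian _ (sub_nonneg.2 hst)]
    simp

/-- Induction on the number of increments: the wave of the earlier ones has modulus one and is
measurable at the last node, so it can be absorbed into the test variable. -/
lemma HasGaussianIncrements.integral_mul_wave_sum {S : Set ℝ} {A : ℝ → ℝ} {K : ℝ → Ω → State d}
    (h : HasGaussianIncrements P 𝓕 S A K) {σ : ℕ → ℝ} (hσ : Monotone σ) (a : ℕ → ℝ) (n : ℕ)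
    (hS : ∀ i ≤ n, σ i ∈ S) {Y : Ω → ℂ} (hY : Measurable[𝓕 (σ 0)] Y) (hY1 : ∀ ω, ‖Y ω‖ ≤ 1)
    (u : State d) :
    ∫ ω, Y ω * wave u (∑ i ∈ Finset.range n, a i • (K (σ (i + 1)) ω - K (σ i) ω)) ∂P =
      (∫ ω, Y ω ∂P) *
        gaussChar u (∑ i ∈ Finset.range n, a i ^ 2 * (A (σ (i + 1)) - A (σ i))) := by
  induction n with
  | zero => simp
  | succ n ih =>
    have hmeas : ∀ m ≤ n, Measurable[𝓕 (σ n)]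
        (fun ω => ∑ i ∈ Finset.range m, a i • (K (σ (i + 1)) ω - K (σ i) ω)) := by
      intro m hm
      refine Finset.measurable_fun_sum _ fun i hi => ?_
      have hi' : i < m := Finset.mem_range.1 hi
      have hK : ∀ j ≤ n, Measurable[𝓕 (σ n)] (K (σ j)) := fun j hj =>
        (h.adapted _ (hS _ (by omega))).mono (𝓕.mono (hσ hj)) le_rfl
      exact ((hK (i + 1) (by omega)).sub (hK i (by omega))).const_smul (a i)
    have := h.integral_mul_wave (σ n) (hS _ (by omega)) (σ (n + 1)) (hS _ le_rfl)
      (hσ (by omega))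
      (fun ω => Y ω * wave u (∑ i ∈ Finset.range n, a i • (K (σ (i + 1)) ω - K (σ i) ω)))
      ((hY.mono (𝓕.mono (hσ (by omega))) le_rfl).mul
        ((measurable_wave u).comp (hmeas n le_rfl)))
      (by intro ω; simpa using hY1 ω) (a n • u)
    simp only [Finset.sum_range_succ, wave_add, wave_smul_right u, gaussChar_add, ← mul_assoc]
    simp only [gaussChar_smul] at this
    rw [this, ih fun i hi => hS i (by omega)]

/-- Dominated convergence: the identity defining Gaussian increments survives almost sure limits as
soon as the variances converge. -/
lemma integral_mul_wave_of_tendsto [IsFiniteMeasure P] {L : ℕ → Ω → State d} {L' : Ω → State d}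
    (hL : ∀ n, AEStronglyMeasurable (L n) P)
    (hlim : ∀ᵐ ω ∂P, Tendsto (fun n => L n ω) atTop (𝓝 (L' ω)))
    {V : ℕ → ℝ} {v : ℝ} (hV : Tendsto V atTop (𝓝 v)) {Y : Ω → ℂ}
    (hY : AEStronglyMeasurable Y P) (hY1 : ∀ ω, ‖Y ω‖ ≤ 1) (u : State d)
    (h : ∀ n, ∫ ω, Y ω * wave u (L n ω) ∂P = (∫ ω, Y ω ∂P) * gaussChar u (V n)) :
    ∫ ω, Y ω * wave u (L' ω) ∂P = (∫ ω, Y ω ∂P) * gaussChar u v := by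
  have h1 : Tendsto (fun n => ∫ ω, Y ω * wave u (L n ω) ∂P) atTop
      (𝓝 (∫ ω, Y ω * wave u (L' ω) ∂P)) := by
    refine tendsto_integral_of_dominated_convergence (fun _ => 1) (fun n => ?_)
      (integrable_const _) (fun n => ?_) ?_
    · exact hY.mul ((continuous_wave u).comp_aestronglyMeasurable (hL n))
    · exact ae_of_all _ fun ω => by simpa using hY1 ω
    · filter_upwards [hlim] with ω hω
      exact (((continuous_wave u).tendsto _).comp hω).const_mul _
  simp only [h] at h1
  exact tendsto_nhds_unique h1 (((continuous_gaussChar u).tendsto v |>.comp hV).const_mul _)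

end BridgeMixture

/-! ### Second moments and the Itô isometry for step functions -/

namespace BridgeMixture

open Filter Topology

variable {d : ℕ}

lemma memLp_two_isoGaussian (m : State d) (v : ℝ) : MemLp id 2 (isoGaussian m v) :=
  IsGaussian.memLp_two_id

lemma integral_id_isoGaussian (m : State d) (v : ℝ) : ∫ x, x ∂(isoGaussian m v) = m :=
  integral_id_multivariateGaussian

lemma integral_norm_sq_isoGaussian {v : ℝ} (hv : 0 ≤ v) :
    ∫ x, ‖x‖ ^ 2 ∂(isoGaussian (0 : State d) v) = d * v := by
  have hmem : ∀ i : Fin d, MemLp (fun x : State d => x i) 2 (isoGaussian (0 : State d) v) :=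
    fun i => (EuclideanSpace.proj (𝕜 := ℝ) i).comp_memLp' (memLp_two_isoGaussian 0 v)
  simp_rw [EuclideanSpace.real_norm_sq_eq]
  rw [integral_finsetSum _ fun i _ => (hmem i).integrable_sq]
  have hvar : ∀ i : Fin d, ∫ x : State d, x i ^ 2 ∂(isoGaussian (0 : State d) v) = v := by
    intro i
    have h0 : ∫ x : State d, x i ∂(isoGaussian (0 : State d) v) = 0 := by
      have := (EuclideanSpace.proj (𝕜 := ℝ) i).integral_comp_comm
        ((memLp_two_isoGaussian (0 : State d) v).integrable (by norm_num))
      simpa [integral_id_isoGaussian] using this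
    have h1 := variance_eval_multivariateGaussian (μ := (0 : State d))
      (posSemidef_smul_one (d := d) hv) i
    change Var[fun x : State d => x i; isoGaussian (0 : State d) v] = _ at h1
    rw [variance_of_integral_eq_zero (by fun_prop) h0] at h1
    simpa using h1
  simp [hvar]

lemma integrable_inner_of_memLp {Ω : Type*} {mΩ : MeasurableSpace Ω} {P : Measure Ω}
    {f g : Ω → State d} (hf : MemLp f 2 P) (hg : MemLp g 2 P) :
    Integrable (fun ω => inner ℝ (f ω) (g ω)) P :=
  (hf.norm.integrable_mul hg.norm).mono (hf.1.inner hg.1)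
    (ae_of_all _ fun ω => by simpa using norm_inner_le_norm (𝕜 := ℝ) (f ω) (g ω))

section Isometry

variable {Ω : Type} {mΩ : MeasurableSpace Ω} {P : Measure Ω} {𝓕 : Filtration ℝ mΩ} {T : ℝ≥0}
  {W : ℝ → Ω → State d}

lemma IsBrownianMotion.memLp_increment (hW : IsBrownianMotion P 𝓕 T W) {s t : ℝ} (hs : 0 ≤ s)
    (hst : s ≤ t) (ht : t ≤ T) : MemLp (fun ω => W t ω - W s ω) 2 P := by
  have hlaw := hW.hasLaw_increment s t hs hst ht
  have := memLp_two_isoGaussian (0 : State d) (t - s)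
  rw [← hlaw.map_eq] at this
  exact (memLp_map_measure_iff this.1 hlaw.aemeasurable).1 this

lemma IsBrownianMotion.increment_zero_ae_eq (hW : IsBrownianMotion P 𝓕 T W) (t : ℝ) :
    (fun ω => W t ω - W 0 ω) =ᵐ[P] W t := by
  filter_upwards [hW.zero] with ω hω
  simp [hω]

lemma IsBrownianMotion.memLp (hW : IsBrownianMotion P 𝓕 T W) {t : ℝ}
    (ht : t ∈ Set.Icc (0 : ℝ) T) : MemLp (W t) 2 P :=
  (memLp_congr_ae (hW.increment_zero_ae_eq t)).1 (hW.memLp_increment le_rfl ht.1 ht.2)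

lemma IsBrownianMotion.integral_inner_of_le (hW : IsBrownianMotion P 𝓕 T W)
    [IsProbabilityMeasure P] {s t : ℝ} (hs : 0 ≤ s) (hst : s ≤ t) (ht : t ≤ T) :
    ∫ ω, inner ℝ (W s ω) (W t ω) ∂P = d * s := by
  have hWs := hW.memLp (t := s) ⟨hs, hst.trans ht⟩
  have hinc := hW.memLp_increment hs hst ht
  have hlaw := hW.hasLaw_increment s t hs hst ht
  have hlaw0 : HasLaw (W s) (isoGaussian 0 s) P := by
    have := hW.hasLaw_increment 0 s le_rfl hs (hst.trans ht)
    rw [sub_zero] at this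
    exact this.congr (hW.increment_zero_ae_eq s).symm
  have hind : IndepFun (W s) (fun ω => W t ω - W s ω) P :=
    (indep_of_indep_of_le_right (hW.indep_increment s t hs hst ht)
      (hW.adapted s ⟨hs, hst.trans ht⟩).comap_le).symm
  have h1 : ∫ ω, inner ℝ (W s ω) (W t ω - W s ω) ∂P = 0 := by
    have := hind.integral_bilin (hWs.integrable (by norm_num)) (hinc.integrable (by norm_num))
      (innerSL ℝ)
    rw [hlaw.integral_eq, integral_id_isoGaussian] at this
    rw [map_zero] at this
    exact this
  have h2 : ∫ ω, ‖W s ω‖ ^ 2 ∂P = d * s := by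
    rw [← integral_norm_sq_isoGaussian hs]
    exact hlaw0.integral_comp (f := fun x : State d => ‖x‖ ^ 2) (by fun_prop)
  have hsplit : ∀ ω, inner ℝ (W s ω) (W t ω) =
      ‖W s ω‖ ^ 2 + inner ℝ (W s ω) (W t ω - W s ω) := by
    intro ω
    rw [inner_sub_right, real_inner_self_eq_norm_sq]; ring
  simp_rw [hsplit]
  rw [integral_add, h1, h2, add_zero]
  · exact (memLp_two_iff_integrable_sq_norm hWs.1).1 hWs
  · exact integrable_inner_of_memLp hWs hinc

lemma IsBrownianMotion.integral_inner (hW : IsBrownianMotion P 𝓕 T W) [IsProbabilityMeasure P]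
    {s t : ℝ} (hs : s ∈ Set.Icc (0 : ℝ) T) (ht : t ∈ Set.Icc (0 : ℝ) T) :
    ∫ ω, inner ℝ (W s ω) (W t ω) ∂P = d * min s t := by
  rcases le_total s t with h | h
  · rw [hW.integral_inner_of_le hs.1 h ht.2, min_eq_left h]
  · simp_rw [real_inner_comm (W t _)]
    rw [hW.integral_inner_of_le ht.1 h hs.2, min_eq_right h]

/-- The indicator function of `(0, t]`. -/
noncomputable def upTo (t : ℝ) : ℝ → ℝ := (Set.Ioc 0 t).indicator 1

lemma memLp_upTo (t : ℝ) : MemLp (upTo t) 2 volume :=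
  memLp_indicator_const 2 measurableSet_Ioc (1 : ℝ) (Or.inr (by simp))

lemma integral_upTo_mul {s t : ℝ} (hs : 0 ≤ s) (ht : 0 ≤ t) :
    ∫ x, upTo s x * upTo t x = min s t := by
  have : ∀ x, upTo s x * upTo t x = (Set.Ioc 0 (min s t)).indicator 1 x := by
    intro x
    rw [upTo, upTo, ← Set.inter_indicator_mul, Set.Ioc_inter_Ioc]
    simp [Pi.one_def]
  simp_rw [this]
  rw [integral_indicator_one measurableSet_Ioc]
  simp [hs, ht]

/-- The graph of the Wiener integral on the span of the indicators of the intervals `(0, t]`. -/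
def wienerGraph (T : ℝ≥0) (W : ℝ → Ω → State d) : Submodule ℝ ((Ω → State d) × (ℝ → ℝ)) :=
  Submodule.span ℝ {p | ∃ t ∈ Set.Icc (0 : ℝ) T, p = (W t, upTo t)}

lemma IsBrownianMotion.memLp_of_mem_wienerGraph (hW : IsBrownianMotion P 𝓕 T W)
    {p : (Ω → State d) × (ℝ → ℝ)} (hp : p ∈ wienerGraph T W) :
    MemLp p.1 2 P ∧ MemLp p.2 2 volume := by
  induction hp using Submodule.span_induction with
  | mem p hp => obtain ⟨t, ht, rfl⟩ := hp; exact ⟨hW.memLp ht, memLp_upTo t⟩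
  | zero => exact ⟨MemLp.zero, MemLp.zero⟩
  | add p q _ _ hp hq => exact ⟨hp.1.add hq.1, hp.2.add hq.2⟩
  | smul c p _ hp => exact ⟨hp.1.const_smul c, hp.2.const_smul c⟩

/-- Both sides are bilinear, and on generators they equal d · min s t. Working with pairs (integral,
integrand) avoids showing that the integral of a step function is independent of its representation.
-/
lemma IsBrownianMotion.integral_inner_of_mem_wienerGraph (hW : IsBrownianMotion P 𝓕 T W)
    [IsProbabilityMeasure P] {p q : (Ω → State d) × (ℝ → ℝ)} (hp : p ∈ wienerGraph T W)
    (hq : q ∈ wienerGraph T W) :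
    ∫ ω, inner ℝ (p.1 ω) (q.1 ω) ∂P = d * ∫ x, p.2 x * q.2 x := by
  induction hp, hq using Submodule.span_induction₂ with
  | mem_mem p q hp hq =>
    obtain ⟨s, hs, rfl⟩ := hp
    obtain ⟨t, ht, rfl⟩ := hq
    simp only
    rw [hW.integral_inner hs ht, integral_upTo_mul hs.1 ht.1]
  | zero_left q hq => simp
  | zero_right p hp => simp
  | add_left p p' q hp hp' hq ih ih' =>
    have h1 := hW.memLp_of_mem_wienerGraph hp
    have h2 := hW.memLp_of_mem_wienerGraph hp'
    have h3 := hW.memLp_of_mem_wienerGraph hq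
    simp only [Prod.fst_add, Prod.snd_add, Pi.add_apply, inner_add_left, add_mul]
    rw [integral_add (integrable_inner_of_memLp h1.1 h3.1) (integrable_inner_of_memLp h2.1 h3.1),
      integral_add (f := fun x => p.2 x * q.2 x) (g := fun x => p'.2 x * q.2 x)
        (h1.2.integrable_mul h3.2) (h2.2.integrable_mul h3.2), ih, ih']
    ring
  | add_right p q q' hp hq hq' ih ih' =>
    have h1 := hW.memLp_of_mem_wienerGraph hp
    have h2 := hW.memLp_of_mem_wienerGraph hq
    have h3 := hW.memLp_of_mem_wienerGraph hq'
    simp only [Prod.fst_add, Prod.snd_add, Pi.add_apply, inner_add_right, mul_add]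
    rw [integral_add (integrable_inner_of_memLp h1.1 h2.1) (integrable_inner_of_memLp h1.1 h3.1),
      integral_add (f := fun x => p.2 x * q.2 x) (g := fun x => p.2 x * q'.2 x)
        (h1.2.integrable_mul h2.2) (h1.2.integrable_mul h3.2), ih, ih']
    ring
  | smul_left r p q hp hq ih =>
    simp only [Prod.smul_fst, Prod.smul_snd, Pi.smul_apply, inner_smul_left, smul_eq_mul,
      mul_assoc, integral_const_mul, ih]
    simp; ring
  | smul_right r p q hp hq ih =>
    simp only [Prod.smul_fst, Prod.smul_snd, Pi.smul_apply, inner_smul_right, smul_eq_mul,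
      mul_left_comm, integral_const_mul, ih]

lemma IsBrownianMotion.lintegral_of_mem_wienerGraph (hW : IsBrownianMotion P 𝓕 T W)
    [IsProbabilityMeasure P] {p : (Ω → State d) × (ℝ → ℝ)} (hp : p ∈ wienerGraph T W) :
    ∫⁻ ω, ‖p.1 ω‖ₑ ^ 2 ∂P = d * ∫⁻ x, ‖p.2 x‖ₑ ^ 2 := by
  have h := hW.memLp_of_mem_wienerGraph hp
  have h1 := (memLp_two_iff_integrable_sq_norm h.1.1).1 h.1
  have h2 := (memLp_two_iff_integrable_sq_norm h.2.1).1 h.2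
  have h3 := hW.integral_inner_of_mem_wienerGraph hp hp
  have hsq : ∀ x, p.2 x * p.2 x = ‖p.2 x‖ ^ 2 := fun x => by rw [Real.norm_eq_abs, sq_abs, pow_two]
  simp_rw [real_inner_self_eq_norm_sq, hsq] at h3
  have e1 : ∀ {E : Type} [NormedAddCommGroup E] (z : E), ‖z‖ₑ ^ 2 = ENNReal.ofReal (‖z‖ ^ 2) := by
    intro E _ z
    rw [ENNReal.ofReal_pow (norm_nonneg _), ofReal_norm]
  simp_rw [e1]
  rw [← ofReal_integral_eq_lintegral_ofReal h1 (ae_of_all _ fun _ => by positivity),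
    ← ofReal_integral_eq_lintegral_ofReal h2 (ae_of_all _ fun _ => by positivity), h3,
    ENNReal.ofReal_mul (by positivity)]
  simp

lemma upTo_sub_upTo {a b : ℝ} (ha : 0 ≤ a) (hab : a ≤ b) :
    upTo b - upTo a = (Set.Ioc a b).indicator 1 := by
  ext x
  simp only [upTo, Pi.sub_apply, Set.indicator, Set.mem_Ioc, Pi.one_apply]
  by_cases h0 : 0 < x <;> by_cases h1 : x ≤ a <;> by_cases h2 : x ≤ b <;>
    simp [h0, h1, h2] <;> linarith

lemma mem_wienerGraph_step {n : ℕ} {τ : ℕ → ℝ} (c : ℕ → ℝ) (hτ : Monotone τ)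
    (h0 : 0 ≤ τ 0) (hT : τ n ≤ T) :
    (stepIntegral W n τ c, stepFun n τ c) ∈ wienerGraph T W := by
  have hmem : ∀ i ≤ n, (W (τ i), upTo (τ i)) ∈ wienerGraph T W := fun i hi =>
    Submodule.subset_span ⟨τ i, ⟨h0.trans (hτ (Nat.zero_le i)), (hτ hi).trans hT⟩, rfl⟩
  have : (stepIntegral W n τ c, stepFun n τ c) = ∑ i ∈ Finset.range n,
      c i • ((W (τ (i + 1)), upTo (τ (i + 1))) - (W (τ i), upTo (τ i))) := by
    refine Prod.ext ?_ ?_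
    · ext1 ω
      simp [stepIntegral, Prod.fst_sum]
    · simp only [Prod.snd_sum, Prod.smul_snd, Prod.snd_sub]
      ext1 x
      rw [stepFun, Finset.sum_apply]
      refine Finset.sum_congr rfl fun i _ => ?_
      rw [upTo_sub_upTo (h0.trans (hτ (Nat.zero_le i))) (hτ (Nat.le_succ i))]
      simp [Set.indicator]
  rw [this]
  refine Submodule.sum_mem _ fun i hi => Submodule.smul_mem _ _ (Submodule.sub_mem _ ?_ ?_)
  · exact hmem _ (Finset.mem_range.1 hi)
  · exact hmem _ (Finset.mem_range.1 hi).le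

end Isometry

end BridgeMixture

/-! ### Increments of Wiener integrals -/

namespace BridgeMixture

open Filter Topology

variable {d : ℕ}

section Step

lemma stepFun_succ (n : ℕ) (τ c : ℕ → ℝ) (x : ℝ) :
    stepFun (n + 1) τ c x =
      stepFun n τ c x + (Set.Ioc (τ n) (τ (n + 1))).indicator (fun _ => c n) x := by
  simp [stepFun, Finset.sum_range_succ]

lemma stepFun_eq_zero {n : ℕ} {τ : ℕ → ℝ} (hτ : Monotone τ) (c : ℕ → ℝ) {x : ℝ}
    (hx : x ∉ Set.Ioc (τ 0) (τ n)) : stepFun n τ c x = 0 := by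
  refine Finset.sum_eq_zero fun i hi => Set.indicator_of_notMem (fun h => hx ?_) _
  exact ⟨(hτ (Nat.zero_le i)).trans_lt h.1, h.2.trans (hτ (Finset.mem_range.1 hi))⟩

lemma stepFun_sq {n : ℕ} {τ : ℕ → ℝ} (hτ : Monotone τ) (c : ℕ → ℝ) (x : ℝ) :
    stepFun n τ c x ^ 2 = stepFun n τ (fun i => c i ^ 2) x := by
  induction n with
  | zero => simp [stepFun]
  | succ n ih =>
    rw [stepFun_succ, stepFun_succ, ← ih]
    by_cases h : x ∈ Set.Ioc (τ n) (τ (n + 1))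
    · rw [stepFun_eq_zero hτ c (x := x) (fun h' => absurd h'.2 (not_le.2 h.1))]
      simp [h]
    · simp [h]

lemma stepFun_max {n : ℕ} (τ c : ℕ → ℝ) {s x : ℝ} (hx : s < x) :
    stepFun n (fun i => max (τ i) s) c x = stepFun n τ c x := by
  refine Finset.sum_congr rfl fun i _ => ?_
  simp [Set.indicator, hx, hx.not_ge]

lemma stepFun_min {n : ℕ} (τ c : ℕ → ℝ) {s x : ℝ} (hx : x ≤ s) :
    stepFun n (fun i => min (τ i) s) c x = stepFun n τ c x := by
  refine Finset.sum_congr rfl fun i _ => ?_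
  simp [Set.indicator, hx, hx.not_gt]

lemma integral_stepFun {n : ℕ} {τ : ℕ → ℝ} (hτ : Monotone τ) (c : ℕ → ℝ) :
    ∫ x, stepFun n τ c x = ∑ i ∈ Finset.range n, c i * (τ (i + 1) - τ i) := by
  unfold stepFun
  rw [integral_finsetSum]
  · refine Finset.sum_congr rfl fun i _ => ?_
    rw [integral_indicator measurableSet_Ioc]
    simp [hτ (Nat.le_succ i), mul_comm]
  · intro i _
    exact (integrable_indicator_iff measurableSet_Ioc).2 (integrableOn_const (by simp))

lemma setIntegral_stepFun_sq {n : ℕ} {τ : ℕ → ℝ} (hτ : Monotone τ) (c : ℕ → ℝ) {s t : ℝ}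
    (h0 : τ 0 ≤ s) (hn : τ n = t) (hst : s ≤ t) :
    ∫ x in Set.Ioc s t, stepFun n τ c x ^ 2 =
      ∑ i ∈ Finset.range n, c i ^ 2 * (max (τ (i + 1)) s - max (τ i) s) := by
  have hσ : Monotone (fun i => max (τ i) s) := fun i j hij => max_le_max_right s (hτ hij)
  rw [← integral_stepFun hσ (fun i => c i ^ 2), setIntegral_congr_fun measurableSet_Ioc
    (g := stepFun n (fun i => max (τ i) s) (fun i => c i ^ 2))]
  · refine setIntegral_eq_integral_of_forall_compl_eq_zero fun x hx => stepFun_eq_zero hσ _ ?_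
    simpa [h0, hn, hst] using hx
  · intro x hx
    simp only
    rw [stepFun_max _ _ hx.1, stepFun_sq hτ]

/-- Splits a step integral at s: clamping the nodes by min keeps the part before s, clamping by max
the part after s. -/
lemma stepIntegral_eq_add {Ω : Type} (W : ℝ → Ω → State d) (n : ℕ) (τ c : ℕ → ℝ) (s : ℝ) (ω : Ω) :
    stepIntegral W n τ c ω = stepIntegral W n (fun i => min (τ i) s) c ω +
      stepIntegral W n (fun i => max (τ i) s) c ω := by
  have key : ∀ a : ℝ, W a ω = W (min a s) ω + W (max a s) ω - W s ω := by
    intro a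
    rcases le_total a s with h | h <;> simp [h]
  rw [stepIntegral, stepIntegral, stepIntegral, ← Finset.sum_add_distrib]
  refine Finset.sum_congr rfl fun i _ => ?_
  rw [key (τ (i + 1)), key (τ i), ← smul_add]
  congr 1
  abel

lemma memLp_stepFun (n : ℕ) (τ c : ℕ → ℝ) (μ : Measure ℝ) [IsLocallyFiniteMeasure μ] :
    MemLp (stepFun n τ c) 2 μ := by
  refine memLp_finsetSum (Finset.range n) fun i _ => ?_
  exact memLp_indicator_const 2 measurableSet_Ioc _ (Or.inr measure_Ioc_lt_top.ne)

end Step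

lemma eLpNorm_two_sq {α E : Type*} {m : MeasurableSpace α} {μ : Measure α} [NormedAddCommGroup E]
    (f : α → E) : eLpNorm f 2 μ ^ 2 = ∫⁻ x, ‖f x‖ₑ ^ 2 ∂μ := by
  have := eLpNorm_nnreal_pow_eq_lintegral (f := f) (μ := μ) (p := 2) (by norm_num)
  simp only [NNReal.coe_ofNat, ENNReal.coe_ofNat, ENNReal.rpow_ofNat] at this
  exact this

lemma integral_sq_eq_eLpNorm {α : Type*} {m : MeasurableSpace α} {μ : Measure α} {f : α → ℝ}
    (hf : MemLp f 2 μ) : ∫ x, f x ^ 2 ∂μ = (eLpNorm f 2 μ).toReal ^ 2 := by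
  rw [← ENNReal.toReal_pow, eLpNorm_two_sq, integral_eq_lintegral_of_nonneg_ae
    (f := fun x => f x ^ 2)
    (ae_of_all _ fun _ => by positivity) (hf.1.pow 2)]
  congr 1
  refine lintegral_congr fun x => ?_
  rw [← sq_abs, ENNReal.ofReal_pow (abs_nonneg _), ← Real.norm_eq_abs, ofReal_norm]

lemma tendsto_integral_sq {α : Type*} {m : MeasurableSpace α} {μ : Measure α} {f : α → ℝ}
    {g : ℕ → α → ℝ} (hf : MemLp f 2 μ) (hg : ∀ n, MemLp (g n) 2 μ)
    (h : Tendsto (fun n => eLpNorm (f - g n) 2 μ) atTop (𝓝 0)) :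
    Tendsto (fun n => ∫ x, g n x ^ 2 ∂μ) atTop (𝓝 (∫ x, f x ^ 2 ∂μ)) := by
  have h1 : Tendsto (fun n => (hg n).toLp) atTop (𝓝 hf.toLp) := by
    rw [Lp.tendsto_Lp_iff_tendsto_eLpNorm'']
    simpa [eLpNorm_sub_comm] using h
  simp_rw [integral_sq_eq_eLpNorm hf, fun n => integral_sq_eq_eLpNorm (hg n), ← Lp.norm_toLp _ hf,
    fun n => (Lp.norm_toLp _ (hg n)).symm]
  exact h1.norm.pow 2

section Increments

variable {Ω : Type} {mΩ : MeasurableSpace Ω} {P : Measure Ω} {𝓕 : Filtration ℝ mΩ} {T : ℝ≥0}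
  {W : ℝ → Ω → State d}

lemma IsStochasticIntegral.exists_step {f : ℝ → ℝ} {t : ℝ} {J : Ω → State d}
    (h : IsStochasticIntegral P W f t J) {ε : ℝ≥0∞} (hε : 0 < ε) :
    ∃ (n : ℕ) (τ c : ℕ → ℝ), Monotone τ ∧ τ 0 = 0 ∧ τ n = t ∧
      eLpNorm (f - stepFun n τ c) 2 (volume.restrict (Set.Ioc 0 t)) < ε ∧
      eLpNorm (J - stepIntegral W n τ c) 2 P < ε := by
  obtain ⟨n, τ, c, h1, h2, h3, h4, h5⟩ := h (ε ^ 2) (by positivity)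
  refine ⟨n, τ, c, h1, h2, h3, ?_, ?_⟩
  · refine lt_of_pow_lt_pow_left' 2 ?_
    rw [eLpNorm_two_sq]
    exact h4
  · refine lt_of_pow_lt_pow_left' 2 ?_
    rw [eLpNorm_two_sq]
    exact h5

lemma IsBrownianMotion.eLpNorm_stepIntegral_sub (hW : IsBrownianMotion P 𝓕 T W)
    [IsProbabilityMeasure P] {s : ℝ} (hs : s ≤ T) {n n' : ℕ} {τ τ' : ℕ → ℝ} (c c' : ℕ → ℝ)
    (hτ : Monotone τ) (hτ' : Monotone τ') (h0 : τ 0 = 0) (h0' : τ' 0 = 0)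
    (hn : τ n = s) (hn' : τ' n' = s) :
    eLpNorm (stepIntegral W n τ c - stepIntegral W n' τ' c') 2 P ^ 2 =
      d * eLpNorm (stepFun n τ c - stepFun n' τ' c') 2 (volume.restrict (Set.Ioc 0 s)) ^ 2 := by
  have hmem := Submodule.sub_mem _
    (mem_wienerGraph_step (T := T) (W := W) c hτ h0.ge (hn.trans_le hs))
    (mem_wienerGraph_step (T := T) (W := W) c' hτ' h0'.ge (hn'.trans_le hs))
  have := hW.lintegral_of_mem_wienerGraph hmem
  rw [eLpNorm_two_sq, eLpNorm_two_sq, setLIntegral_eq_of_support_subset]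
  · exact this
  · intro x hx
    by_contra hx'
    refine hx ?_
    simp [stepFun_eq_zero hτ c (x := x) (n := n) (by rwa [h0, hn]),
      stepFun_eq_zero hτ' c' (x := x) (n := n') (by rwa [h0', hn'])]

lemma IsBrownianMotion.aestronglyMeasurable_stepIntegral (hW : IsBrownianMotion P 𝓕 T W)
    {n : ℕ} {τ : ℕ → ℝ} (c : ℕ → ℝ) (hτ : Monotone τ) (h0 : 0 ≤ τ 0) (hT : τ n ≤ T) :
    AEStronglyMeasurable (stepIntegral W n τ c) P :=
  (hW.memLp_of_mem_wienerGraph (mem_wienerGraph_step c hτ h0 hT)).1.1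

/-- The step functions approximating the integrals up to s and up to t are chosen separately. Both
are close to f on (0, s], so by the isometry their integrals over (0, s] are close, and the part
after s of the second one approximates the increment. -/
lemma IsBrownianMotion.exists_step_increment (hW : IsBrownianMotion P 𝓕 T W)
    [IsProbabilityMeasure P] {f : ℝ → ℝ} {s t : ℝ} (hs : 0 ≤ s) (hst : s ≤ t) (ht : t ≤ T)
    (hf : AEStronglyMeasurable f (volume.restrict (Set.Ioc 0 t)))
    {Js Jt : Ω → State d} (hJs : AEStronglyMeasurable Js P) (hJt : AEStronglyMeasurable Jt P)
    (hIs : IsStochasticIntegral P W f s Js) (hIt : IsStochasticIntegral P W f t Jt)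
    {ε : ℝ≥0∞} (hε : 0 < ε) :
    ∃ (n : ℕ) (τ c : ℕ → ℝ), Monotone τ ∧ τ 0 = 0 ∧ τ n = t ∧
      eLpNorm (f - stepFun n τ c) 2 (volume.restrict (Set.Ioc s t)) ≤ ε ∧
      eLpNorm (Jt - Js - stepIntegral W n (fun i => max (τ i) s) c) 2 P ≤ (2 + 2 * d) * ε := by
  obtain ⟨n, τ, c, hτ, h0, hn, hft, hWt⟩ := hIt.exists_step hε
  obtain ⟨n', τ', c', hτ', h0', hn', hfs, hWs⟩ := hIs.exists_step hε
  refine ⟨n, τ, c, hτ, h0, hn, (eLpNorm_mono_measure _ (Measure.restrict_mono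
    (Set.Ioc_subset_Ioc_left hs) le_rfl)).trans hft.le, ?_⟩
  have hσ : Monotone (fun i => min (τ i) s) := fun i j hij => min_le_min_right s (hτ hij)
  have hfs' : AEStronglyMeasurable f (volume.restrict (Set.Ioc 0 s)) :=
    hf.mono_measure (Measure.restrict_mono (Set.Ioc_subset_Ioc_right hst) le_rfl)
  have hcross : eLpNorm (stepIntegral W n (fun i => min (τ i) s) c - stepIntegral W n' τ' c') 2 P
      ≤ (2 * d) * ε := by
    have hstep : eLpNorm (stepFun n (fun i => min (τ i) s) c - stepFun n' τ' c') 2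
        (volume.restrict (Set.Ioc 0 s)) ≤ 2 * ε := by
      have hcongr : (stepFun n (fun i => min (τ i) s) c - stepFun n' τ' c')
          =ᵐ[volume.restrict (Set.Ioc 0 s)]
          (f - stepFun n' τ' c') - (f - stepFun n τ c) := by
        filter_upwards [ae_restrict_mem measurableSet_Ioc] with x hx
        simp [stepFun_min τ c hx.2]
      rw [eLpNorm_congr_ae hcongr, two_mul]
      refine (eLpNorm_sub_le (hfs'.sub (memLp_stepFun _ _ _ _).1)
        (hfs'.sub (memLp_stepFun _ _ _ _).1) (by norm_num)).trans (add_le_add hfs.le ?_)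
      exact (eLpNorm_mono_measure _ (Measure.restrict_mono
        (Set.Ioc_subset_Ioc_right hst) le_rfl)).trans hft.le
    have hiso := hW.eLpNorm_stepIntegral_sub (hst.trans ht) c c' hσ hτ' (by simp [h0, hs]) h0'
      (n := n) (by simp [hn, hst]) hn'
    refine (ENNReal.pow_le_pow_left_iff two_ne_zero).1 ?_
    rw [hiso]
    -- The crude bound d ≤ d² replaces the isometry constant √d by d and avoids a square root.
    calc (d : ℝ≥0∞) * _ ^ 2 ≤ (d : ℝ≥0∞) ^ 2 * (2 * ε) ^ 2 := by
          gcongr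
          exact_mod_cast Nat.le_self_pow two_ne_zero d
      _ = (2 * d * ε) ^ 2 := by ring
  have hsplit : Jt - Js - stepIntegral W n (fun i => max (τ i) s) c =
      (Jt - stepIntegral W n τ c) - (Js - stepIntegral W n' τ' c') +
        (stepIntegral W n (fun i => min (τ i) s) c - stepIntegral W n' τ' c') := by
    ext1 ω
    simp only [Pi.sub_apply, Pi.add_apply, stepIntegral_eq_add W n τ c s]
    abel
  have m1 := hW.aestronglyMeasurable_stepIntegral c hτ h0.ge (hn.trans_le ht)
  have m2 := hW.aestronglyMeasurable_stepIntegral c' hτ' h0'.ge (hn'.trans_le (hst.trans ht))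
  have m3 := hW.aestronglyMeasurable_stepIntegral (n := n) c hσ (by simp [h0, hs])
    (by simp [hn, hst, hst.trans ht])
  rw [hsplit]
  calc _ ≤ eLpNorm ((Jt - stepIntegral W n τ c) - (Js - stepIntegral W n' τ' c')) 2 P +
        eLpNorm (stepIntegral W n (fun i => min (τ i) s) c - stepIntegral W n' τ' c') 2 P :=
        eLpNorm_add_le ((hJt.sub m1).sub (hJs.sub m2)) (m3.sub m2) (by norm_num)
    _ ≤ (ε + ε) + (2 * d) * ε := by
        gcongr
        exact (eLpNorm_sub_le (hJt.sub m1) (hJs.sub m2) (by norm_num)).trans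
          (add_le_add hWt.le hWs.le)
    _ = (2 + 2 * d) * ε := by ring

/-- The increments of a Wiener integral process are independent of the past and Gaussian. -/
lemma IsBrownianMotion.integral_mul_wave_stochasticIntegral_sub (hW : IsBrownianMotion P 𝓕 T W)
    [IsProbabilityMeasure P] {f : ℝ → ℝ} {s t : ℝ} (hs : 0 ≤ s) (hst : s ≤ t) (ht : t ≤ T)
    (hf : MemLp f 2 (volume.restrict (Set.Ioc 0 t)))
    {Js Jt : Ω → State d} (hJs : AEStronglyMeasurable Js P) (hJt : AEStronglyMeasurable Jt P)
    (hIs : IsStochasticIntegral P W f s Js) (hIt : IsStochasticIntegral P W f t Jt)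
    {Y : Ω → ℂ} (hY : Measurable[𝓕 s] Y) (hY1 : ∀ ω, ‖Y ω‖ ≤ 1) (u : State d) :
    ∫ ω, Y ω * wave u (Jt ω - Js ω) ∂P =
      (∫ ω, Y ω ∂P) * gaussChar u (∫ x in Set.Ioc s t, f x ^ 2) := by
  have hex := fun k : ℕ => hW.exists_step_increment hs hst ht hf.1 hJs hJt hIs hIt
    (ε := (k + 1 : ℝ≥0∞)⁻¹) (by simp)
  choose n τ c hτ h0 hn hfk hWk using hex
  have hε : Tendsto (fun k : ℕ => (k + 1 : ℝ≥0∞)⁻¹) atTop (𝓝 0) := by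
    have := (tendsto_add_atTop_iff_nat 1).2 ENNReal.tendsto_inv_nat_nhds_zero
    simpa using this
  have hσ : ∀ k, Monotone (fun i => max (τ k i) s) :=
    fun k i j hij => max_le_max_right s (hτ k hij)
  have hσ0 : ∀ k, max (τ k 0) s = s := fun k => by simp [h0, hs]
  have hσn : ∀ k, max (τ k (n k)) s = t := fun k => by simp [hn, hst]
  have hmeas : ∀ k, AEStronglyMeasurable (stepIntegral W (n k) (fun i => max (τ k i) s) (c k)) P :=
    fun k => hW.aestronglyMeasurable_stepIntegral (c k) (hσ k) (by simp [h0, hs])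
      (by rw [hσn]; exact ht)
  have hlim : Tendsto (fun k =>
      eLpNorm (stepIntegral W (n k) (fun i => max (τ k i) s) (c k) - (Jt - Js)) 2 P)
      atTop (𝓝 0) := by
    refine tendsto_of_tendsto_of_tendsto_of_le_of_le tendsto_const_nhds
      (h := fun k : ℕ => (2 + 2 * d : ℝ≥0∞) * (k + 1 : ℝ≥0∞)⁻¹) ?_ (fun _ => zero_le) ?_
    · have := ENNReal.Tendsto.const_mul (a := (2 + 2 * d : ℝ≥0∞)) hε (Or.inr (by finiteness))
      simpa using this
    · intro k
      simp only
      rw [eLpNorm_sub_comm]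
      exact hWk k
  -- L² convergence gives almost sure convergence along a subsequence, which is enough to identify
  -- the limit.
  obtain ⟨ns, hns, hae⟩ :=
    (tendstoInMeasure_of_tendsto_eLpNorm (by norm_num) hmeas (hJt.sub hJs) hlim).exists_seq_tendsto_ae
  have hfst : MemLp f 2 (volume.restrict (Set.Ioc s t)) :=
    hf.mono_measure (Measure.restrict_mono (Set.Ioc_subset_Ioc_left hs) le_rfl)
  have hV : Tendsto (fun k => ∫ x in Set.Ioc s t, stepFun (n k) (τ k) (c k) x ^ 2) atTop
      (𝓝 (∫ x in Set.Ioc s t, f x ^ 2)) :=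
    tendsto_integral_sq hfst (fun k => memLp_stepFun _ _ _ _)
      (tendsto_of_tendsto_of_tendsto_of_le_of_le tendsto_const_nhds hε (fun _ => zero_le) hfk)
  have hsum : ∀ k, ∫ ω, Y ω * wave u (stepIntegral W (n k) (fun i => max (τ k i) s) (c k) ω) ∂P =
      (∫ ω, Y ω ∂P) *
        gaussChar u (∫ x in Set.Ioc s t, stepFun (n k) (τ k) (c k) x ^ 2) := by
    intro k
    rw [setIntegral_stepFun_sq (hτ k) (c k) ((h0 k).trans_le hs) (hn k) hst]
    refine hW.hasGaussianIncrements.integral_mul_wave_sum (hσ k) (c k) (n k) (fun i hi => ?_)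
      (by rwa [hσ0]) hY1 u
    refine ⟨hs.trans (le_max_right _ _), ?_⟩
    exact ((hσ k hi).trans_eq (hσn k)).trans ht
  exact integral_mul_wave_of_tendsto (fun k => hmeas (ns k)) hae (hV.comp hns.tendsto_atTop)
    (hY.mono (𝓕.le s) le_rfl).aestronglyMeasurable hY1 u (fun k => hsum (ns k))

end Increments

end BridgeMixture

/-! ### The remaining variance and Riemann sums along equidistant meshes -/

namespace BridgeMixture

open Filter Topology

variable {d : ℕ}

section Schedule

variable {ς : ℝ → ℝ} {T : ℝ≥0}

/-- The remaining variance `β_T - β_t`. -/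
noncomputable def remVar (ς : ℝ → ℝ) (T : ℝ≥0) (t : ℝ) : ℝ := accVar ς T - accVar ς t

lemma intervalIntegrable_sq (hς : MemLp ς 2 (volume.restrict (Set.Icc (0 : ℝ) T))) {s t : ℝ}
    (hs : s ∈ Set.Icc (0 : ℝ) T) (ht : t ∈ Set.Icc (0 : ℝ) T) :
    IntervalIntegrable (fun u => ς u ^ 2) volume s t := by
  have h : IntegrableOn (fun u => ς u ^ 2) (Set.Icc (0 : ℝ) T) := hς.integrable_sq
  exact (h.mono_set (Set.uIcc_subset_Icc hs ht)).intervalIntegrable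

lemma accVar_sub (hς : MemLp ς 2 (volume.restrict (Set.Icc (0 : ℝ) T))) {s t : ℝ}
    (hs : s ∈ Set.Icc (0 : ℝ) T) (ht : t ∈ Set.Icc (0 : ℝ) T) :
    accVar ς t - accVar ς s = ∫ u in s..t, ς u ^ 2 := by
  have h0 : (0 : ℝ) ∈ Set.Icc (0 : ℝ) T := ⟨le_rfl, T.2⟩
  exact intervalIntegral.integral_interval_sub_left (intervalIntegrable_sq hς h0 ht)
    (intervalIntegrable_sq hς h0 hs)

lemma continuousOn_accVar (hς : MemLp ς 2 (volume.restrict (Set.Icc (0 : ℝ) T))) :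
    ContinuousOn (accVar ς) (Set.Icc (0 : ℝ) T) := by
  have h : IntegrableOn (fun u => ς u ^ 2) (Set.Icc (0 : ℝ) T) := hς.integrable_sq
  have := intervalIntegral.continuousOn_primitive_interval (a := 0) (b := (T : ℝ)) (μ := volume)
    (f := fun u => ς u ^ 2) (by rwa [Set.uIcc_of_le T.coe_nonneg])
  rwa [Set.uIcc_of_le T.coe_nonneg] at this

lemma accVar_lt (hς : MemLp ς 2 (volume.restrict (Set.Icc (0 : ℝ) T)))
    (hpos : ∀ t ∈ Set.Icc (0 : ℝ) T, 0 < ς t) {s t : ℝ} (hs : 0 ≤ s) (hst : s < t) (ht : t ≤ T) :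
    accVar ς s < accVar ς t := by
  rw [← sub_pos, accVar_sub hς ⟨hs, hst.le.trans ht⟩ ⟨hs.trans hst.le, ht⟩]
  refine intervalIntegral.intervalIntegral_pos_of_pos_on
    (intervalIntegrable_sq hς ⟨hs, hst.le.trans ht⟩ ⟨hs.trans hst.le, ht⟩) (fun x hx => ?_) hst
  have := hpos x ⟨hs.trans hx.1.le, hx.2.le.trans ht⟩
  positivity

lemma accVar_mono (hς : MemLp ς 2 (volume.restrict (Set.Icc (0 : ℝ) T)))
    (hpos : ∀ t ∈ Set.Icc (0 : ℝ) T, 0 < ς t) {s t : ℝ} (hs : 0 ≤ s) (hst : s ≤ t) (ht : t ≤ T) :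
    accVar ς s ≤ accVar ς t := by
  rcases hst.eq_or_lt with rfl | h
  · rfl
  · exact (accVar_lt hς hpos hs h ht).le

lemma remVar_pos (hς : MemLp ς 2 (volume.restrict (Set.Icc (0 : ℝ) T)))
    (hpos : ∀ t ∈ Set.Icc (0 : ℝ) T, 0 < ς t) {t : ℝ} (ht : t ∈ Set.Ico (0 : ℝ) T) :
    0 < remVar ς T t :=
  sub_pos.2 (accVar_lt hς hpos ht.1 ht.2 le_rfl)

lemma remVar_anti (hς : MemLp ς 2 (volume.restrict (Set.Icc (0 : ℝ) T)))
    (hpos : ∀ t ∈ Set.Icc (0 : ℝ) T, 0 < ς t) {s t : ℝ} (hs : 0 ≤ s) (hst : s ≤ t) (ht : t ≤ T) :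
    remVar ς T t ≤ remVar ς T s :=
  sub_le_sub_left (accVar_mono hς hpos hs hst ht) _

lemma continuousOn_remVar (hς : MemLp ς 2 (volume.restrict (Set.Icc (0 : ℝ) T))) :
    ContinuousOn (remVar ς T) (Set.Icc (0 : ℝ) T) :=
  continuousOn_const.sub (continuousOn_accVar hς)

lemma inv_remVar_mono (hς : MemLp ς 2 (volume.restrict (Set.Icc (0 : ℝ) T)))
    (hpos : ∀ t ∈ Set.Icc (0 : ℝ) T, 0 < ς t) {s t : ℝ} (hs : 0 ≤ s) (hst : s ≤ t) (ht : t < T) :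
    (remVar ς T s)⁻¹ ≤ (remVar ς T t)⁻¹ :=
  inv_anti₀ (remVar_pos hς hpos ⟨hs.trans hst, ht⟩) (remVar_anti hς hpos hs hst ht.le)

lemma continuousOn_inv_remVar (hς : MemLp ς 2 (volume.restrict (Set.Icc (0 : ℝ) T)))
    (hpos : ∀ t ∈ Set.Icc (0 : ℝ) T, 0 < ς t) :
    ContinuousOn (fun t => (remVar ς T t)⁻¹) (Set.Ico (0 : ℝ) T) :=
  ((continuousOn_remVar hς).mono Set.Ico_subset_Icc_self).inv₀
    fun _ ht => (remVar_pos hς hpos ht).ne'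

end Schedule

section Mesh

/-- The subdivision of `[s, t]` into `m + 1` intervals of equal length. -/
noncomputable def mesh (s t : ℝ) (m i : ℕ) : ℝ :=
  s + (min i (m + 1) : ℕ) / ((m : ℝ) + 1) * (t - s)

@[simp] lemma mesh_zero (s t : ℝ) (m : ℕ) : mesh s t m 0 = s := by simp [mesh]

@[simp] lemma mesh_last (s t : ℝ) (m : ℕ) : mesh s t m (m + 1) = t := by
  have : (m : ℝ) + 1 ≠ 0 := by positivity
  simp [mesh, this]

lemma mesh_mono {s t : ℝ} (hst : s ≤ t) (m : ℕ) : Monotone (mesh s t m) := by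
  intro i j hij
  have h : (min i (m + 1) : ℕ) ≤ (min j (m + 1) : ℕ) := min_le_min_right _ hij
  have h' : ((min i (m + 1) : ℕ) : ℝ) ≤ (min j (m + 1) : ℕ) := by exact_mod_cast h
  have := sub_nonneg.2 hst
  unfold mesh
  gcongr

lemma mesh_mem {s t : ℝ} (hst : s ≤ t) (m i : ℕ) : mesh s t m i ∈ Set.Icc s t := by
  constructor
  · simpa using mesh_mono hst m (Nat.zero_le i)
  · rcases le_total i (m + 1) with h | h
    · simpa using mesh_mono hst m h
    · have : mesh s t m i = mesh s t m (m + 1) := by simp [mesh, h]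
      simp [this]

lemma mesh_succ_sub {s t : ℝ} (hst : s ≤ t) (m i : ℕ) :
    mesh s t m (i + 1) - mesh s t m i ≤ (t - s) / (m + 1) := by
  have h : (min (i + 1) (m + 1) : ℕ) ≤ (min i (m + 1) : ℕ) + 1 := by omega
  have h' : ((min (i + 1) (m + 1) : ℕ) : ℝ) ≤ (min i (m + 1) : ℕ) + 1 := by exact_mod_cast h
  have := sub_nonneg.2 hst
  have e : mesh s t m (i + 1) - mesh s t m i =
    (((min (i + 1) (m + 1) : ℕ) : ℝ) - (min i (m + 1) : ℕ)) * ((t - s) / (m + 1)) := by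
    unfold mesh; ring
  rw [e]
  calc _ ≤ 1 * ((t - s) / (m + 1)) := by
        gcongr
        linarith
    _ = _ := one_mul _

lemma eventually_oscillation_le {E : Type*} [NormedAddCommGroup E] {G : ℝ → E} {s t : ℝ}
    (hst : s ≤ t) (hG : ContinuousOn G (Set.Icc s t)) {ε : ℝ} (hε : 0 < ε) :
    ∀ᶠ m : ℕ in atTop, ∀ i, ∀ u ∈ Set.Icc (mesh s t m i) (mesh s t m (i + 1)),
      ‖G u - G (mesh s t m (i + 1))‖ ≤ ε := by
  have huc := isCompact_Icc.uniformContinuousOn_of_continuous hG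
  obtain ⟨δ, hδ, hGδ⟩ := Metric.uniformContinuousOn_iff.1 huc ε hε
  have hlim : Tendsto (fun m : ℕ => (t - s) / ((m : ℝ) + 1)) atTop (𝓝 0) :=
    tendsto_const_div_atTop_nhds_zero_nat (t - s) |>.comp (tendsto_add_atTop_nat 1) |>.congr
      (by intro m; simp)
  filter_upwards [hlim.eventually (gt_mem_nhds hδ)] with m hm i u hu
  have h1 := mesh_mem hst m i
  have h2 := mesh_mem hst m (i + 1)
  have h3 := mesh_succ_sub hst m i
  have := hGδ u ⟨h1.1.trans hu.1, hu.2.trans h2.2⟩ _ h2 (by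
    rw [Real.dist_eq, abs_of_nonpos (by linarith [hu.2])]
    linarith [hu.1])
  rw [dist_eq_norm] at this
  exact this.le

/-- Local errors that are o(1) relative to the increments of β, uniformly in the cell, add up to
o(1), since these increments telescope. -/
lemma tendsto_sum_of_le_increment {E : Type*} [NormedAddCommGroup E] {β : ℝ → ℝ} {s t : ℝ}
    (hβ : β s ≤ β t) {e : ℕ → ℕ → E}
    (h : ∀ ε > 0, ∀ᶠ m : ℕ in atTop, ∀ i,
      ‖e m i‖ ≤ ε * (β (mesh s t m (i + 1)) - β (mesh s t m i))) :
    Tendsto (fun m => ∑ i ∈ Finset.range (m + 1), e m i) atTop (𝓝 0) := by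
  rw [Metric.tendsto_atTop']
  intro ε hε
  -- The added 1 keeps the denominator positive when β t = β s.
  have hε' : 0 < ε / (β t - β s + 1) := div_pos hε (by linarith)
  obtain ⟨M, hM⟩ := eventually_atTop.1 (h _ hε')
  refine ⟨M, fun m hm => ?_⟩
  rw [dist_zero_right]
  calc ‖∑ i ∈ Finset.range (m + 1), e m i‖ ≤ ∑ i ∈ Finset.range (m + 1), ‖e m i‖ :=
        norm_sum_le _ _
    _ ≤ ∑ i ∈ Finset.range (m + 1),
          ε / (β t - β s + 1) * (β (mesh s t m (i + 1)) - β (mesh s t m i)) :=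
        Finset.sum_le_sum fun i _ => hM m hm.le i
    _ = ε / (β t - β s + 1) * (β t - β s) := by
        rw [← Finset.mul_sum, Finset.sum_range_sub (fun i => β (mesh s t m i)), mesh_last,
          mesh_zero]
    _ < ε := by
        rw [div_mul_eq_mul_div, div_lt_iff₀ (by linarith)]
        nlinarith

end Mesh

end BridgeMixture

/-! ### Removing the drift from the bridge equation -/

namespace BridgeMixture

open Filter Topology

variable {d : ℕ}

section Solution

variable {ς : ℝ → ℝ} {T : ℝ≥0}

lemma continuous_pos_apply (z : Traj d T) : Continuous (fun t => pos t z) :=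
  z.continuous.Icc_extend'

/-- The martingale part `Z_t - Z_0 - ∫_0^t b(s, Z_s) ds` of the bridge dynamics. -/
noncomputable def bridgeNoise (ς : ℝ → ℝ) (T : ℝ≥0) (x : State d) (z : Traj d T) (t : ℝ) :
    State d :=
  pos t z - pos 0 z - ∫ s in (0 : ℝ)..t, bridgeDrift ς T x (pos s z) s

/-- The rescaled distance `(Z_t - x) / (β_T - β_t)` to the end point. -/
noncomputable def scaledGap (ς : ℝ → ℝ) (T : ℝ≥0) (x : State d) (z : Traj d T) (t : ℝ) :
    State d :=
  (remVar ς T t)⁻¹ • (pos t z - x)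

lemma bridgeDrift_eq (x : State d) (z : Traj d T) (t : ℝ) :
    bridgeDrift ς T x (pos t z) t = ς t ^ 2 • -scaledGap ς T x z t := by
  rw [bridgeDrift, scaledGap, div_eq_mul_inv, mul_smul, ← smul_neg, neg_sub, remVar]

lemma continuousOn_scaledGap (hς : MemLp ς 2 (volume.restrict (Set.Icc (0 : ℝ) T)))
    (hpos : ∀ t ∈ Set.Icc (0 : ℝ) T, 0 < ς t) (x : State d) (z : Traj d T) :
    ContinuousOn (scaledGap ς T x z) (Set.Ico (0 : ℝ) T) :=
  (continuousOn_inv_remVar hς hpos).smul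
    ((continuous_pos_apply z).sub continuous_const).continuousOn

lemma intervalIntegrable_smul_of_continuousOn
    (hς : MemLp ς 2 (volume.restrict (Set.Icc (0 : ℝ) T))) {E : Type*} [NormedAddCommGroup E]
    [NormedSpace ℝ E] {G : ℝ → E} (hG : ContinuousOn G (Set.Ico (0 : ℝ) T)) {s t : ℝ}
    (hs : s ∈ Set.Ico (0 : ℝ) T) (ht : t ∈ Set.Ico (0 : ℝ) T) :
    IntervalIntegrable (fun u => ς u ^ 2 • G u) volume s t :=
  (intervalIntegrable_sq hς ⟨hs.1, hs.2.le⟩ ⟨ht.1, ht.2.le⟩).smul_continuousOn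
    (hG.mono (Set.ordConnected_Ico.uIcc_subset hs ht))

lemma bridgeNoise_sub (hς : MemLp ς 2 (volume.restrict (Set.Icc (0 : ℝ) T)))
    (hpos : ∀ t ∈ Set.Icc (0 : ℝ) T, 0 < ς t) (x : State d) (z : Traj d T) {s t : ℝ}
    (hs : s ∈ Set.Ico (0 : ℝ) T) (ht : t ∈ Set.Ico (0 : ℝ) T) :
    bridgeNoise ς T x z t - bridgeNoise ς T x z s =
      pos t z - pos s z + ∫ u in s..t, ς u ^ 2 • scaledGap ς T x z u := by
  have h0 : (0 : ℝ) ∈ Set.Ico (0 : ℝ) T := ⟨le_rfl, hs.1.trans_lt hs.2⟩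
  have hintegral := fun r (hr : r ∈ Set.Ico (0 : ℝ) T) =>
    intervalIntegrable_smul_of_continuousOn hς (continuousOn_scaledGap hς hpos x z) h0 hr
  have := intervalIntegral.integral_interval_sub_left (hintegral t ht) (hintegral s hs)
  simp only [bridgeNoise, bridgeDrift_eq, smul_neg, intervalIntegral.integral_neg, ← this]
  abel

/-- Pathwise integration by parts on one interval. With J the noise, r_t G_t - r_s G_s = J_t - J_s -
∫ ς² G; inserting r_t = r_s - ∫ ς² leaves as error only the oscillation of G weighted by ς². -/
lemma scaledGap_sub_sub (hς : MemLp ς 2 (volume.restrict (Set.Icc (0 : ℝ) T)))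
    (hpos : ∀ t ∈ Set.Icc (0 : ℝ) T, 0 < ς t) (x : State d) (z : Traj d T) {s t : ℝ}
    (hs : s ∈ Set.Ico (0 : ℝ) T) (ht : t ∈ Set.Ico (0 : ℝ) T) :
    scaledGap ς T x z t - scaledGap ς T x z s -
        (remVar ς T s)⁻¹ • (bridgeNoise ς T x z t - bridgeNoise ς T x z s) =
      -((remVar ς T s)⁻¹ •
        ∫ u in s..t, ς u ^ 2 • (scaledGap ς T x z u - scaledGap ς T x z t)) := by
  have hs0 := (remVar_pos hς hpos hs).ne'
  have ht0 := (remVar_pos hς hpos ht).ne'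
  have hw : accVar ς t - accVar ς s = ∫ u in s..t, ς u ^ 2 :=
    accVar_sub hς ⟨hs.1, hs.2.le⟩ ⟨ht.1, ht.2.le⟩
  have hr : remVar ς T s - remVar ς T t = ∫ u in s..t, ς u ^ 2 := by
    rw [← hw, remVar, remVar]; ring
  simp_rw [smul_sub (ς _ ^ 2)]
  rw [intervalIntegral.integral_sub
    (intervalIntegrable_smul_of_continuousOn hς (continuousOn_scaledGap hς hpos x z) hs ht)
    (intervalIntegrable_smul_of_continuousOn hς continuousOn_const hs ht),
    intervalIntegral.integral_smul_const, ← hr, bridgeNoise_sub hς hpos x z hs ht]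
  generalize (∫ u in s..t, ς u ^ 2 • scaledGap ς T x z u) = A
  have hpt : pos t z - x = remVar ς T t • scaledGap ς T x z t := by
    rw [scaledGap, smul_inv_smul₀ ht0]
  have hps : pos s z - x = remVar ς T s • scaledGap ς T x z s := by
    rw [scaledGap, smul_inv_smul₀ hs0]
  have : pos t z - pos s z =
      remVar ς T t • scaledGap ς T x z t - remVar ς T s • scaledGap ς T x z s := by
    rw [← hpt, ← hps]; abel
  rw [this]
  simp only [smul_add, smul_sub, sub_smul, inv_smul_smul₀ hs0]
  abel

lemma norm_scaledGap_sub_sub_le (hς : MemLp ς 2 (volume.restrict (Set.Icc (0 : ℝ) T)))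
    (hpos : ∀ t ∈ Set.Icc (0 : ℝ) T, 0 < ς t) (x : State d) (z : Traj d T) {s t : ℝ}
    (hs : s ∈ Set.Ico (0 : ℝ) T) (ht : t ∈ Set.Ico (0 : ℝ) T) (hst : s ≤ t) {ε : ℝ}
    (hε : ∀ u ∈ Set.Icc s t, ‖scaledGap ς T x z u - scaledGap ς T x z t‖ ≤ ε) :
    ‖scaledGap ς T x z t - scaledGap ς T x z s -
        (remVar ς T s)⁻¹ • (bridgeNoise ς T x z t - bridgeNoise ς T x z s)‖ ≤
      (remVar ς T s)⁻¹ * (ε * (accVar ς t - accVar ς s)) := by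
  have hs0 := remVar_pos hς hpos hs
  rw [scaledGap_sub_sub hς hpos x z hs ht, norm_neg, norm_smul, Real.norm_eq_abs,
    abs_of_pos (inv_pos.2 hs0)]
  refine mul_le_mul_of_nonneg_left ?_ (inv_pos.2 hs0).le
  rw [accVar_sub hς ⟨hs.1, hs.2.le⟩ ⟨ht.1, ht.2.le⟩, ← intervalIntegral.integral_const_mul]
  refine intervalIntegral.norm_integral_le_of_norm_le hst (ae_of_all _ fun u hu => ?_)
    ((intervalIntegrable_sq hς ⟨hs.1, hs.2.le⟩ ⟨ht.1, ht.2.le⟩).const_mul ε)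
  rw [norm_smul, Real.norm_eq_abs, abs_of_nonneg (by positivity), mul_comm]
  exact mul_le_mul_of_nonneg_right (hε u ⟨hu.1.le, hu.2⟩) (by positivity)

lemma mesh_mem_Ico {s t : ℝ} (hs : 0 ≤ s) (hst : s ≤ t) (ht : t < T) (m i : ℕ) :
    mesh s t m i ∈ Set.Ico (0 : ℝ) T :=
  ⟨hs.trans (mesh_mem hst m i).1, (mesh_mem hst m i).2.trans_lt ht⟩

/-- The integral of 1/r against the noise is a pathwise limit of left-endpoint sums because 1/r is
deterministic and G is continuous; no stochastic calculus is needed. -/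
lemma tendsto_sum_bridgeNoise (hς : MemLp ς 2 (volume.restrict (Set.Icc (0 : ℝ) T)))
    (hpos : ∀ t ∈ Set.Icc (0 : ℝ) T, 0 < ς t) (x : State d) (z : Traj d T) {s t : ℝ}
    (hs : 0 ≤ s) (hst : s ≤ t) (ht : t < T) :
    Tendsto (fun m => ∑ i ∈ Finset.range (m + 1), (remVar ς T (mesh s t m i))⁻¹ •
        (bridgeNoise ς T x z (mesh s t m (i + 1)) - bridgeNoise ς T x z (mesh s t m i)))
      atTop (𝓝 (scaledGap ς T x z t - scaledGap ς T x z s)) := by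
  have ht0 := remVar_pos hς hpos ⟨hs.trans hst, ht⟩
  have hmem := mesh_mem_Ico hs hst ht
  have herr := tendsto_sum_of_le_increment (β := accVar ς) (s := s) (t := t)
    (accVar_mono hς hpos hs hst ht.le)
    (e := fun m i => scaledGap ς T x z (mesh s t m (i + 1)) - scaledGap ς T x z (mesh s t m i) -
        (remVar ς T (mesh s t m i))⁻¹ •
          (bridgeNoise ς T x z (mesh s t m (i + 1)) - bridgeNoise ς T x z (mesh s t m i)))
    (by
      intro ε hε
      have hG : ContinuousOn (scaledGap ς T x z) (Set.Icc s t) :=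
        (continuousOn_scaledGap hς hpos x z).mono
          fun u hu => ⟨hs.trans hu.1, hu.2.trans_lt ht⟩
      -- The tolerance ε r_t absorbs the factor 1/r at the left node, which is at most 1/r_t.
      filter_upwards [eventually_oscillation_le hst hG (mul_pos hε ht0)] with m hm i
      refine (norm_scaledGap_sub_sub_le hς hpos x z (hmem m i) (hmem m (i + 1))
        (mesh_mono hst m (Nat.le_succ i)) (hm i)).trans ?_
      have h1 := inv_remVar_mono hς hpos (hmem m i).1 (mesh_mem hst m i).2 ht
      have h2 := sub_nonneg.2 (accVar_mono hς hpos (hmem m i).1 (mesh_mono hst m (Nat.le_succ i))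
        (hmem m (i + 1)).2.le)
      calc _ ≤ (remVar ς T t)⁻¹ * (ε * remVar ς T t *
            (accVar ς (mesh s t m (i + 1)) - accVar ς (mesh s t m i))) := by gcongr
        _ = _ := by field_simp)
  have := herr.const_sub (scaledGap ς T x z t - scaledGap ς T x z s)
  rw [sub_zero] at this
  refine this.congr fun m => ?_
  rw [Finset.sum_sub_distrib, Finset.sum_range_sub (fun i => scaledGap ς T x z (mesh s t m i)),
    mesh_last, mesh_zero, sub_sub_cancel]

/-- The variance of the rescaled noise: since dβ = -dr, the integral of r⁻² dβ is the increment of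
1/r. -/
lemma tendsto_sum_inv_remVar_sq (hς : MemLp ς 2 (volume.restrict (Set.Icc (0 : ℝ) T)))
    (hpos : ∀ t ∈ Set.Icc (0 : ℝ) T, 0 < ς t) {s t : ℝ}
    (hs : 0 ≤ s) (hst : s ≤ t) (ht : t < T) :
    Tendsto (fun m => ∑ i ∈ Finset.range (m + 1), (remVar ς T (mesh s t m i))⁻¹ ^ 2 *
        (accVar ς (mesh s t m (i + 1)) - accVar ς (mesh s t m i)))
      atTop (𝓝 ((remVar ς T t)⁻¹ - (remVar ς T s)⁻¹)) := by
  have ht0 := remVar_pos hς hpos ⟨hs.trans hst, ht⟩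
  have hmem := mesh_mem_Ico hs hst ht
  have herr := tendsto_sum_of_le_increment (β := accVar ς) (s := s) (t := t)
    (accVar_mono hς hpos hs hst ht.le)
    (e := fun m i => (remVar ς T (mesh s t m (i + 1)))⁻¹ - (remVar ς T (mesh s t m i))⁻¹ -
        (remVar ς T (mesh s t m i))⁻¹ ^ 2 *
          (accVar ς (mesh s t m (i + 1)) - accVar ς (mesh s t m i)))
    (by
      intro ε hε
      have hG : ContinuousOn (fun u => (remVar ς T u)⁻¹) (Set.Icc s t) :=
        (continuousOn_inv_remVar hς hpos).mono
          fun u hu => ⟨hs.trans hu.1, hu.2.trans_lt ht⟩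
      filter_upwards [eventually_oscillation_le hst hG (mul_pos hε ht0)] with m hm i
      have hm := hm i (mesh s t m i) ⟨le_rfl, mesh_mono hst m (Nat.le_succ i)⟩
      have h1 := inv_remVar_mono hς hpos (hmem m i).1 (mesh_mem hst m i).2 ht
      have h2 := sub_nonneg.2 (accVar_mono hς hpos (hmem m i).1 (mesh_mono hst m (Nat.le_succ i))
        (hmem m (i + 1)).2.le)
      have p1 := remVar_pos hς hpos (hmem m i)
      have p2 := remVar_pos hς hpos (hmem m (i + 1))
      have e : (remVar ς T (mesh s t m (i + 1)))⁻¹ - (remVar ς T (mesh s t m i))⁻¹ -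
          (remVar ς T (mesh s t m i))⁻¹ ^ 2 *
            (accVar ς (mesh s t m (i + 1)) - accVar ς (mesh s t m i)) =
          -((remVar ς T (mesh s t m i))⁻¹ *
            (((remVar ς T (mesh s t m i))⁻¹ - (remVar ς T (mesh s t m (i + 1)))⁻¹) *
            (accVar ς (mesh s t m (i + 1)) - accVar ς (mesh s t m i)))) := by
        have : accVar ς (mesh s t m (i + 1)) - accVar ς (mesh s t m i) =
            remVar ς T (mesh s t m i) - remVar ς T (mesh s t m (i + 1)) := by
          rw [remVar, remVar]; ring
        rw [this]
        field_simp
        ring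
      rw [e, norm_neg, norm_mul, norm_mul, Real.norm_of_nonneg (inv_pos.2 p1).le,
        Real.norm_of_nonneg h2]
      calc _ ≤ (remVar ς T t)⁻¹ * (ε * remVar ς T t *
            (accVar ς (mesh s t m (i + 1)) - accVar ς (mesh s t m i))) := by gcongr
        _ = _ := by field_simp)
  have := herr.const_sub ((remVar ς T t)⁻¹ - (remVar ς T s)⁻¹)
  rw [sub_zero] at this
  refine this.congr fun m => ?_
  rw [Finset.sum_sub_distrib, Finset.sum_range_sub (fun i => (remVar ς T (mesh s t m i))⁻¹),
    mesh_last, mesh_zero, sub_sub_cancel]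

/-- The σ-algebra on Ω is arbitrary, so the statement yields adaptedness and not only measurability.
-/
lemma measurable_setIntegral_smul_of_continuous {Ω : Type*} {m : MeasurableSpace Ω} {s : Set ℝ}
    {k : ℝ → ℝ} (hk : AEStronglyMeasurable k (volume.restrict s)) {z : ℝ → Ω → State d}
    (hz : ∀ u, Measurable (z u)) (hc : ∀ ω, Continuous fun u => z u ω) :
    Measurable fun ω => ∫ u in s, k u • z u ω := by
  have h1 : ∀ ω, ∫ u in s, k u • z u ω = ∫ u in s, hk.mk k u • z u ω := by
    intro ω
    refine integral_congr_ae ?_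
    filter_upwards [hk.ae_eq_mk] with u hu
    rw [hu]
  simp_rw [h1]
  have hz' : Measurable (Function.uncurry z) := measurable_uncurry_of_continuous_of_measurable hc hz
  have : StronglyMeasurable (Function.uncurry fun (ω : Ω) (u : ℝ) => hk.mk k u • z u ω) := by
    refine Measurable.stronglyMeasurable ?_
    refine Measurable.smul (hk.measurable_mk.comp measurable_snd) ?_
    exact hz'.comp measurable_swap
  exact this.integral_prod_right.measurable

section Weak

variable {Ω : Type} {mΩ : MeasurableSpace Ω} {P : Measure Ω} {𝓕 : Filtration ℝ mΩ}
  {W : ℝ → Ω → State d} {Z : Ω → Traj d T} {x : State d} {μ₀ : Measure (State d)}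

lemma pos_max_zero (z : Traj d T) (u : ℝ) : pos (max 0 u) z = pos u z := by
  rcases le_total 0 u with h | h
  · simp [h]
  · rw [max_eq_left h]
    exact (Set.IccExtend_of_le_left T.2 _ le_rfl).trans (Set.IccExtend_of_le_left T.2 _ h).symm

lemma IsBridgeSolution.measurable_bridgeNoise (hB : IsBridgeSolution ς T x μ₀ P 𝓕 W Z)
    (hς : MemLp ς 2 (volume.restrict (Set.Icc (0 : ℝ) T)))
    (hpos : ∀ t ∈ Set.Icc (0 : ℝ) T, 0 < ς t) {t : ℝ} (ht : t ∈ Set.Ico (0 : ℝ) T) :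
    Measurable[𝓕 t] (fun ω => bridgeNoise ς T x (Z ω) t) := by
  have hZ : ∀ u ∈ Set.Icc 0 t, Measurable[𝓕 t] (fun ω => pos u (Z ω)) := fun u hu =>
    (hB.adapted u ⟨hu.1, hu.2.trans ht.2.le⟩).mono (𝓕.mono hu.2) le_rfl
  have hk : AEStronglyMeasurable (fun u => ς u ^ 2 * (remVar ς T u)⁻¹)
      (volume.restrict (Set.Ioc 0 t)) := by
    have h0 : (0 : ℝ) ∈ Set.Ico (0 : ℝ) T := ⟨le_rfl, ht.1.trans_lt ht.2⟩
    have := intervalIntegrable_smul_of_continuousOn hς (continuousOn_inv_remVar hς hpos) h0 ht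
    exact this.1.aestronglyMeasurable
  -- Clamping the time to [0, t] makes the integrand 𝓕 t-measurable at every real time without
  -- changing it on (0, t].
  have hm : Measurable[𝓕 t] fun ω => ∫ u in Set.Ioc 0 t, (ς u ^ 2 * (remVar ς T u)⁻¹) •
      (x - pos (max 0 (min u t)) (Z ω)) := by
    refine @measurable_setIntegral_smul_of_continuous d Ω (𝓕 t) _ _ hk
      (fun u ω => x - pos (max 0 (min u t)) (Z ω)) (fun u => ?_) (fun ω => ?_)
    · exact (hZ _ ⟨le_max_left _ _, max_le ht.1 (min_le_right _ _)⟩).const_sub x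
    · exact continuous_const.sub ((continuous_pos_apply (Z ω)).comp (by fun_prop))
  have he : (fun ω => bridgeNoise ς T x (Z ω) t) = fun ω => pos t (Z ω) - pos 0 (Z ω) -
      ∫ u in Set.Ioc 0 t, (ς u ^ 2 * (remVar ς T u)⁻¹) • (x - pos (max 0 (min u t)) (Z ω)) := by
    ext1 ω
    rw [bridgeNoise, intervalIntegral.integral_of_le ht.1]
    congr 1
    refine setIntegral_congr_fun measurableSet_Ioc fun u hu => ?_
    rw [pos_max_zero, min_eq_left hu.2, bridgeDrift, div_eq_mul_inv, remVar]
  rw [he]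
  exact ((hZ t ⟨ht.1, le_rfl⟩).sub (hZ 0 ⟨le_rfl, ht.1⟩)).sub hm

lemma IsBridgeSolution.hasGaussianIncrements_bridgeNoise [IsProbabilityMeasure P]
    (hB : IsBridgeSolution ς T x μ₀ P 𝓕 W Z)
    (hς : MemLp ς 2 (volume.restrict (Set.Icc (0 : ℝ) T)))
    (hpos : ∀ t ∈ Set.Icc (0 : ℝ) T, 0 < ς t) :
    HasGaussianIncrements P 𝓕 (Set.Ico (0 : ℝ) T) (accVar ς)
      (fun t ω => bridgeNoise ς T x (Z ω) t) where
  adapted t ht := hB.measurable_bridgeNoise hς hpos ht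
  integral_mul_wave s hs t ht hst Y hY hY1 u := by
    have hm : ∀ r ∈ Set.Ico (0 : ℝ) T,
        AEStronglyMeasurable (fun ω => bridgeNoise ς T x (Z ω) r) P := fun r hr =>
      ((hB.measurable_bridgeNoise hς hpos hr).mono (𝓕.le r) le_rfl).aestronglyMeasurable
    rw [accVar_sub hς ⟨hs.1, hs.2.le⟩ ⟨ht.1, ht.2.le⟩, intervalIntegral.integral_of_le hst]
    exact hB.brownian.integral_mul_wave_stochasticIntegral_sub hs.1 hst ht.2.le
      (hς.mono_measure (Measure.restrict_mono
        (Set.Ioc_subset_Icc_self.trans (Set.Icc_subset_Icc_right ht.2.le)) le_rfl))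
      (hm s hs) (hm t ht) (hB.sde s hs) (hB.sde t ht) hY hY1 u

/-- Along a solution of the bridge dynamics the process `(Z_t - x) / (β_T - β_t)` is a Brownian
motion run with the clock `1 / (β_T - β_t)`. -/
lemma IsBridgeSolution.hasGaussianIncrements_scaledGap [IsProbabilityMeasure P]
    (hB : IsBridgeSolution ς T x μ₀ P 𝓕 W Z)
    (hς : MemLp ς 2 (volume.restrict (Set.Icc (0 : ℝ) T)))
    (hpos : ∀ t ∈ Set.Icc (0 : ℝ) T, 0 < ς t) :
    HasGaussianIncrements P 𝓕 (Set.Ico (0 : ℝ) T) (fun t => (remVar ς T t)⁻¹)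
      (fun t ω => scaledGap ς T x (Z ω) t) where
  adapted t ht := ((hB.adapted t ⟨ht.1, ht.2.le⟩).sub_const x).const_smul (remVar ς T t)⁻¹
  integral_mul_wave s hs t ht hst Y hY hY1 u := by
    have hJ := hB.hasGaussianIncrements_bridgeNoise hς hpos
    have hmem := mesh_mem_Ico hs.1 hst ht.2
    refine integral_mul_wave_of_tendsto (L := fun m ω => ∑ i ∈ Finset.range (m + 1),
        (remVar ς T (mesh s t m i))⁻¹ • (bridgeNoise ς T x (Z ω) (mesh s t m (i + 1)) -
          bridgeNoise ς T x (Z ω) (mesh s t m i))) (fun m => ?_)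
      (ae_of_all _ fun ω => tendsto_sum_bridgeNoise hς hpos x (Z ω) hs.1 hst ht.2)
      (tendsto_sum_inv_remVar_sq hς hpos hs.1 hst ht.2)
      (hY.mono (𝓕.le s) le_rfl).aestronglyMeasurable hY1 u (fun m => ?_)
    · have hK : ∀ i, Measurable (fun ω => bridgeNoise ς T x (Z ω) (mesh s t m i)) := fun i =>
        (hJ.adapted _ (hmem m i)).mono (𝓕.le _) le_rfl
      exact (Finset.measurable_fun_sum _ fun i _ =>
        ((hK (i + 1)).sub (hK i)).const_smul
          (remVar ς T (mesh s t m i))⁻¹).aestronglyMeasurable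
    · exact hJ.integral_mul_wave_sum (mesh_mono hst m) (fun i => (remVar ς T (mesh s t m i))⁻¹)
        (m + 1) (fun i _ => hmem m i) (by rwa [mesh_zero]) hY1 u

end Weak

end Solution

end BridgeMixture

/-! ### The law of the bridge on path space -/

namespace BridgeMixture

open Filter Topology

variable {d : ℕ}

section Law

variable {ς : ℝ → ℝ} {T : ℝ≥0}

/-- The canonical filtration `s ↦ σ(Z_u : 0 ≤ u ≤ s)` on the path space. -/
noncomputable def pastFiltration (d : ℕ) (T : ℝ≥0) : Filtration ℝ (instMeasurableSpaceTraj d T) where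
  seq := past d T
  mono' _ _ hst := iSup₂_mono' fun u hu => ⟨u, ⟨hu.1, hu.2.trans hst⟩, le_rfl⟩
  le' := past_le d T

lemma measurable_pos_past {u s : ℝ} (hu : u ∈ Set.Icc 0 s) :
    Measurable[past d T s] (pos u : Traj d T → State d) :=
  measurable_iff_comap_le.2
    (le_iSup₂ (f := fun u (_ : u ∈ Set.Icc (0 : ℝ) s) =>
      MeasurableSpace.comap (pos u : Traj d T → State d) inferInstance) u hu)

/-- The properties of the law of the bridge towards `x` that determine it. -/
structure IsBridgeMeasure (ς : ℝ → ℝ) (T : ℝ≥0) (x : State d) (μ₀ : Measure (State d))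
    (Q : Measure (Traj d T)) : Prop where
  isProbabilityMeasure : IsProbabilityMeasure Q
  init : HasLaw (pos 0) μ₀ Q
  increments : HasGaussianIncrements Q (pastFiltration d T) (Set.Ico (0 : ℝ) T)
    (fun t => (remVar ς T t)⁻¹) (fun t z => scaledGap ς T x z t)
  terminal : ∀ᵐ z ∂Q, pos T z = x

lemma measurable_past_of_adapted {Ω : Type*} {m : MeasurableSpace Ω} {Z : Ω → Traj d T} {s : ℝ}
    (hZ : ∀ u ∈ Set.Icc 0 s, Measurable fun ω => pos u (Z ω)) :
    @Measurable _ _ m (past d T s) Z := by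
  rw [measurable_iff_comap_le, MeasurableSpace.comap_iSup]
  refine iSup_le fun u => ?_
  rw [MeasurableSpace.comap_iSup]
  refine iSup_le fun hu => ?_
  rw [MeasurableSpace.comap_comp]
  exact (hZ u hu).comap_le

/-- A test variable of the canonical past, composed with the adapted solution Z, is 𝓕 s-measurable;
the identity is then pushed forward along Z. -/
lemma IsBridgeLaw.hasGaussianIncrements {x : State d} {μ₀ : Measure (State d)}
    {Q : Measure (Traj d T)} (h : IsBridgeLaw ς T x μ₀ Q)
    (hς : MemLp ς 2 (volume.restrict (Set.Icc (0 : ℝ) T)))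
    (hpos : ∀ t ∈ Set.Icc (0 : ℝ) T, 0 < ς t) :
    HasGaussianIncrements Q (pastFiltration d T) (Set.Ico (0 : ℝ) T)
      (fun t => (remVar ς T t)⁻¹) (fun t z => scaledGap ς T x z t) where
  adapted t ht :=
    ((measurable_pos_past ⟨ht.1, le_rfl⟩).sub_const x).const_smul (remVar ς T t)⁻¹
  integral_mul_wave s hs t ht hst Y hY hY1 u := by
    obtain ⟨Ω, mΩ, P, 𝓕, W, Z, hP, hB, hZ⟩ := h
    have hN := hB.hasGaussianIncrements_scaledGap hς hpos
    have hYm : Measurable Y := hY.mono (past_le d T s) le_rfl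
    have hgap : ∀ r, Measurable (fun z : Traj d T => scaledGap ς T x z r) := fun r =>
      ((measurable_pos r).sub_const x).const_smul (remVar ς T r)⁻¹
    have hZs : @Measurable _ _ (𝓕 s) (past d T s) Z :=
      measurable_past_of_adapted (m := 𝓕 s) fun v hv =>
        (hB.adapted v ⟨hv.1, hv.2.trans hs.2.le⟩).mono (𝓕.mono hv.2) le_rfl
    have hYZ : Measurable[𝓕 s] (Y ∘ Z) := @Measurable.comp _ _ _ (𝓕 s) (past d T s) _ Y Z hY hZs
    have h1 := hN.integral_mul_wave s hs t ht hst (Y ∘ Z) hYZ (fun ω => hY1 _) u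
    have h2 : ∫ ω, Y (Z ω) ∂P = ∫ z, Y z ∂Q :=
      hZ.integral_comp hYm.aestronglyMeasurable
    have h3 : ∫ ω, Y (Z ω) * wave u (scaledGap ς T x (Z ω) t - scaledGap ς T x (Z ω) s) ∂P =
        ∫ z, Y z * wave u (scaledGap ς T x z t - scaledGap ς T x z s) ∂Q :=
      hZ.integral_comp
        (f := fun z => Y z * wave u (scaledGap ς T x z t - scaledGap ς T x z s))
        (hYm.mul (measurable_wave_comp ((hgap t).sub (hgap s)) u)).aestronglyMeasurable
    rw [← h2, ← h3]
    exact h1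

lemma integral_wave_pos_sub {x : State d} {Q : Measure (Traj d T)} [IsProbabilityMeasure Q]
    (h : HasGaussianIncrements Q (pastFiltration d T) (Set.Ico (0 : ℝ) T)
      (fun t => (remVar ς T t)⁻¹) (fun t z => scaledGap ς T x z t))
    (hς : MemLp ς 2 (volume.restrict (Set.Icc (0 : ℝ) T)))
    (hpos : ∀ t ∈ Set.Icc (0 : ℝ) T, 0 < ς t) {t : ℝ} (ht : t ∈ Set.Ico (0 : ℝ) T) (u : State d) :
    ∫ z, wave u (pos t z - x - remVar ς T t • scaledGap ς T x z 0) ∂Q =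
      gaussChar u (remVar ς T t - remVar ς T t ^ 2 * (remVar ς T 0)⁻¹) := by
  have ht0 := (remVar_pos hς hpos ht).ne'
  have := h.integral_mul_wave 0 ⟨le_rfl, ht.1.trans_lt ht.2⟩ t ht ht.1 (fun _ => 1)
    measurable_const (by simp) (remVar ς T t • u)
  simp only [one_mul, ← wave_smul_right, smul_sub, gaussChar_smul] at this
  convert this using 1
  · congr 1
    ext z
    simp only [scaledGap, smul_inv_smul₀ ht0, smul_sub]
  · simp only [integral_const, probReal_univ, one_smul, one_mul]
    congr 1
    field_simp

/-- The pinning is not part of the notion of solution. It follows because Z_t - x - r_t G_0 = r_t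
(G_t - G_0) is Gaussian with variance r_t - r_t²/r_0, which tends to 0 as t ↑ T, as does r_t G_0. -/
lemma ae_terminal {x : State d} {Q : Measure (Traj d T)} [IsProbabilityMeasure Q] (hT : 0 < T)
    (h : HasGaussianIncrements Q (pastFiltration d T) (Set.Ico (0 : ℝ) T)
      (fun t => (remVar ς T t)⁻¹) (fun t z => scaledGap ς T x z t))
    (hς : MemLp ς 2 (volume.restrict (Set.Icc (0 : ℝ) T)))
    (hpos : ∀ t ∈ Set.Icc (0 : ℝ) T, 0 < ς t) : ∀ᵐ z ∂Q, pos T z = x := by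
  have hT' : (0 : ℝ) < T := hT
  have hev : ∀ᶠ t in 𝓝[<] (T : ℝ), t ∈ Set.Ico (0 : ℝ) T := Ico_mem_nhdsLT hT'
  have hrem : Tendsto (remVar ς T) (𝓝[<] (T : ℝ)) (𝓝 0) := by
    have := (continuousOn_remVar hς).continuousWithinAt (x := (T : ℝ)) ⟨hT'.le, le_rfl⟩
    have h0 : remVar ς T T = 0 := by simp [remVar]
    rw [ContinuousWithinAt, h0] at this
    refine this.mono_left ?_
    rw [nhdsWithin_le_iff]
    filter_upwards [hev] with t ht using ⟨ht.1, ht.2.le⟩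
  have hgap : ∀ r, Measurable (fun z : Traj d T => scaledGap ς T x z r) := fun r =>
    ((measurable_pos r).sub_const x).const_smul (remVar ς T r)⁻¹
  have hchar : ∀ u : State d, ∫ z, wave u (pos T z - x) ∂Q = 1 := by
    intro u
    have h1 : Tendsto
        (fun t => ∫ z, wave u (pos t z - x - remVar ς T t • scaledGap ς T x z 0) ∂Q)
        (𝓝[<] (T : ℝ)) (𝓝 (∫ z, wave u (pos T z - x) ∂Q)) := by
      refine tendsto_integral_filter_of_dominated_convergence (fun _ => 1)
        (Eventually.of_forall fun t => ?_) (Eventually.of_forall fun t => ?_)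
        (integrable_const _) (ae_of_all _ fun z => ?_)
      · exact (measurable_wave_comp (((measurable_pos t).sub_const x).sub
          ((hgap 0).const_smul (remVar ς T t))) u).aestronglyMeasurable
      · exact ae_of_all _ fun z => by simp
      · refine ((continuous_wave u).tendsto _).comp ?_
        have hc : Tendsto (fun t => pos t z) (𝓝[<] (T : ℝ)) (𝓝 (pos T z)) :=
          ((continuous_pos_apply z).tendsto _).mono_left nhdsWithin_le_nhds
        simpa using (hc.sub_const x).sub (hrem.smul_const (scaledGap ς T x z 0))
    have h2 : Tendsto
        (fun t => ∫ z, wave u (pos t z - x - remVar ς T t • scaledGap ς T x z 0) ∂Q)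
        (𝓝[<] (T : ℝ)) (𝓝 1) := by
      have hv : Tendsto (fun t => remVar ς T t - remVar ς T t ^ 2 * (remVar ς T 0)⁻¹)
          (𝓝[<] (T : ℝ)) (𝓝 0) := by
        simpa using hrem.sub ((hrem.pow 2).mul_const (remVar ς T 0)⁻¹)
      have := ((continuous_gaussChar u).tendsto 0).comp hv
      rw [gaussChar_zero_right] at this
      refine this.congr' ?_
      filter_upwards [hev] with t ht
      exact (integral_wave_pos_sub h hς hpos ht u).symm
    exact tendsto_nhds_unique h1 h2
  have hm : Measurable (fun z : Traj d T => pos T z - x) := (measurable_pos _).sub_const x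
  have hmap : Q.map (fun z => pos T z - x) = Measure.dirac 0 := by
    have := Measure.isProbabilityMeasure_map (μ := Q) hm.aemeasurable
    refine ext_of_integral_wave fun u => ?_
    rw [integral_map hm.aemeasurable (continuous_wave u).aestronglyMeasurable, hchar u]
    simp
  have hlaw : HasLaw (fun z : Traj d T => pos T z - x) (Measure.dirac 0) Q :=
    ⟨hm.aemeasurable, hmap⟩
  filter_upwards [hlaw.ae_eq_of_dirac] with z hz
  exact sub_eq_zero.1 hz

lemma IsBridgeLaw.isBridgeMeasure {x : State d} {μ₀ : Measure (State d)}
    {Q : Measure (Traj d T)} (h : IsBridgeLaw ς T x μ₀ Q) (hT : 0 < T)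
    (hς : MemLp ς 2 (volume.restrict (Set.Icc (0 : ℝ) T)))
    (hpos : ∀ t ∈ Set.Icc (0 : ℝ) T, 0 < ς t) : IsBridgeMeasure ς T x μ₀ Q := by
  have hincr := h.hasGaussianIncrements hς hpos
  obtain ⟨Ω, mΩ, P, 𝓕, W, Z, hP, hB, hZ⟩ := h
  have hQ : IsProbabilityMeasure Q := hZ.isProbabilityMeasure_iff.1 hP
  refine ⟨hQ, ⟨(measurable_pos 0).aemeasurable, ?_⟩, hincr, ae_terminal hT hincr hς hpos⟩
  rw [← hB.init.map_eq, ← hZ.map_eq,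
    AEMeasurable.map_map_of_aemeasurable (measurable_pos 0).aemeasurable hZ.aemeasurable]
  rfl

end Law

end BridgeMixture

/-! ### Conditional expectations, independence and joint characteristic functions -/

namespace BridgeMixture

open Filter Topology

variable {d : ℕ}

section CondExp

variable {Ω A B C : Type*} {mΩ : MeasurableSpace Ω} [MeasurableSpace A] [MeasurableSpace B]
  [MeasurableSpace C] {μ : Measure Ω} [IsProbabilityMeasure μ] {X : Ω → A} {Y : Ω → B} {W : Ω → C}

/-- Information that is independent of `(X, Y)` does not help to predict `Y` from `X`. -/
lemma condExp_preimage_sup_eq (hX : Measurable X) (hY : Measurable Y) (hW : Measurable W)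
    (h : IndepFun W (fun ω => (X ω, Y ω)) μ) {S : Set B} (hS : MeasurableSet S) :
    μ⟦Y ⁻¹' S | MeasurableSpace.comap X inferInstance ⊔ MeasurableSpace.comap W inferInstance⟧
      =ᵐ[μ] μ⟦Y ⁻¹' S | MeasurableSpace.comap X inferInstance⟧ := by
  set f : Ω → ℝ := (Y ⁻¹' S).indicator fun _ => (1 : ℝ) with hf
  have hfi : Integrable f μ := (integrable_const 1).indicator (hY hS)
  have hle : MeasurableSpace.comap X inferInstance ⊔ MeasurableSpace.comap W inferInstance ≤ mΩ :=
    sup_le hX.comap_le hW.comap_le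
  obtain ⟨φ, hφ, hgφ⟩ : ∃ φ : A → ℝ, StronglyMeasurable φ ∧
      μ[f | MeasurableSpace.comap X inferInstance] = φ ∘ X :=
    (stronglyMeasurable_condExp (μ := μ) (f := f)
      (m := MeasurableSpace.comap X inferInstance)).exists_eq_measurable_comp
  have hgm : StronglyMeasurable[MeasurableSpace.comap X inferInstance ⊔
      MeasurableSpace.comap W inferInstance] (μ[f | MeasurableSpace.comap X inferInstance]) :=
    stronglyMeasurable_condExp.mono le_sup_left
  refine (ae_eq_condExp_of_forall_setIntegral_eq hle hfi
    (fun s _ _ => integrable_condExp.integrableOn) ?_ hgm.aestronglyMeasurable).symm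
  intro s hs hfin
  clear hfin
  rw [← MeasurableSpace.comap_prodMk] at hs
  obtain ⟨R, hR, rfl⟩ := hs
  have hXW : Measurable fun ω => (X ω, W ω) := hX.prodMk hW
  -- A π-λ argument over sets of the form {(X, W) ∈ R}; on rectangles, independence factors out the
  -- event on W.
  induction R, hR using MeasurableSpace.induction_on_inter generateFrom_prod.symm isPiSystem_prod with
  | empty => simp
  | basic R hR =>
    obtain ⟨U, hU, V, hV, rfl⟩ := hR
    have hU : MeasurableSet U := hU
    have hV : MeasurableSet V := hV
    have hset : (fun ω => (X ω, W ω)) ⁻¹' (U ×ˢ V) = W ⁻¹' V ∩ X ⁻¹' U := by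
      ext ω; simp [and_comm]
    have key : ∀ g : A × B → ℝ, Measurable g →
        ∫ ω in W ⁻¹' V ∩ X ⁻¹' U, g (X ω, Y ω) ∂μ =
          μ.real (W ⁻¹' V) * ∫ ω in X ⁻¹' U, g (X ω, Y ω) ∂μ := by
      intro g hg
      have hi := Indep.setIntegral_eq_mul (f := (U ×ˢ Set.univ).indicator g) hW.comap_le h
        (hX.prodMk hY).aemeasurable ⟨V, hV, rfl⟩
        (hg.indicator (hU.prod MeasurableSet.univ)).aestronglyMeasurable
      have e : ∀ ω, (U ×ˢ Set.univ).indicator g (X ω, Y ω) =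
          (X ⁻¹' U).indicator (fun ω => g (X ω, Y ω)) ω := by
        intro ω
        by_cases hω : X ω ∈ U <;> simp [hω]
      simp_rw [e] at hi
      rwa [setIntegral_indicator (hX hU), integral_indicator (hX hU)] at hi
    have k1 := key (fun p => φ p.1) (hφ.measurable.comp measurable_fst)
    have k2 := key (fun p => S.indicator (fun _ => (1 : ℝ)) p.2)
      ((measurable_const.indicator hS).comp measurable_snd)
    have k3 : ∫ ω in X ⁻¹' U, φ (X ω) ∂μ = ∫ ω in X ⁻¹' U, f ω ∂μ := by
      rw [← setIntegral_condExp hX.comap_le hfi ⟨U, hU, rfl⟩, hgφ]; rfl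
    rw [hset, hgφ]
    refine k1.trans ?_
    rw [k3]
    exact k2.symm
  | compl R hR ih =>
    rw [Set.preimage_compl, setIntegral_compl (hXW hR) integrable_condExp,
      setIntegral_compl (hXW hR) hfi, ih, integral_condExp hX.comap_le]
  | iUnion R hdisj hR ih =>
    rw [Set.preimage_iUnion]
    have hd : Pairwise (Function.onFun Disjoint fun i => (fun ω => (X ω, W ω)) ⁻¹' R i) :=
      fun i j hij => (hdisj hij).preimage _
    rw [integral_iUnion (fun i => hXW (hR i)) hd integrable_condExp.integrableOn,
      integral_iUnion (fun i => hXW (hR i)) hd hfi.integrableOn]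
    simp_rw [ih]

end CondExp

/-- Riesz representation splits a functional on the product space into one frequency per component,
so the hypothesis is the factorization of the joint characteristic function. -/
lemma indepFun_of_integral_wave {Ω ι : Type*} {mΩ : MeasurableSpace Ω} [Fintype ι] {μ : Measure Ω}
    [IsProbabilityMeasure μ] {D : ι → Ω → State d} {X Y : Ω → State d}
    (hD : ∀ i, Measurable (D i)) (hX : Measurable X) (hY : Measurable Y)
    (h : ∀ (c : ι → State d) (a b : State d),
      ∫ ω, (∏ i, wave (c i) (D i ω)) * (wave a (X ω) * wave b (Y ω)) ∂μ =
        (∫ ω, ∏ i, wave (c i) (D i ω) ∂μ) * ∫ ω, wave a (X ω) * wave b (Y ω) ∂μ) :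
    IndepFun (fun ω i => D i ω) (fun ω => (X ω, Y ω)) μ := by
  classical
  have hD' : Measurable fun ω i => D i ω := measurable_pi_iff.2 hD
  rw [indepFun_iff_charFunDual_prod hD'.aemeasurable (hX.prodMk hY).aemeasurable]
  intro L
  set J := InnerProductSpace.toDual ℝ (State d) with hJ
  set L₁ : StrongDual ℝ (ι → State d) := L.comp (.inl ℝ _ _) with hL₁
  set L₂ : StrongDual ℝ (State d × State d) := L.comp (.inr ℝ _ _) with hL₂
  set c : ι → State d := fun i => J.symm (L₁.comp (.single ℝ (fun _ => State d) i)) with hc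
  set a : State d := J.symm (L₂.comp (.inl ℝ _ _)) with ha
  set b : State d := J.symm (L₂.comp (.inr ℝ _ _)) with hb
  have e1 : ∀ v : ι → State d, L₁ v = ∑ i, inner ℝ (c i) (v i) := by
    intro v
    rw [← ContinuousLinearMap.sum_comp_single ℝ (fun _ : ι => State d) L₁ v]
    simp [hc, hJ]
  have e2 : ∀ v w : State d, L₂ (v, w) = inner ℝ a v + inner ℝ b w := by
    intro v w
    have : (v, w) = (v, 0) + (0, w) := by simp
    rw [this, map_add]
    simp [ha, hb, hJ]
  have e3 : ∀ (v : ι → State d) (w : State d × State d), L (v, w) = L₁ v + L₂ w := by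
    intro v w
    have : (v, w) = (v, 0) + (0, w) := by simp
    rw [this, map_add]
    simp [hL₁, hL₂]
  have w1 : ∀ v : ι → State d, Complex.exp (L₁ v * Complex.I) = ∏ i, wave (c i) (v i) := by
    intro v
    rw [e1]
    simp [wave, Complex.exp_sum, Finset.sum_mul]
  have w2 : ∀ v w : State d, Complex.exp (L₂ (v, w) * Complex.I) = wave a v * wave b w := by
    intro v w
    rw [e2]
    simp [wave, ← Complex.exp_add, add_mul]
  have w3 : ∀ (v : ι → State d) (w : State d × State d), Complex.exp (L (v, w) * Complex.I) =
      (∏ i, wave (c i) (v i)) * (wave a w.1 * wave b w.2) := by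
    intro v w
    rw [e3, ← w1, ← w2, ← Complex.exp_add]
    push_cast
    ring_nf
  rw [charFunDual_apply, charFunDual_apply, charFunDual_apply,
    integral_map (hD'.prodMk (hX.prodMk hY)).aemeasurable (by fun_prop),
    integral_map hD'.aemeasurable (by fun_prop),
    integral_map (hX.prodMk hY).aemeasurable (by fun_prop)]
  simp_rw [w3, w1, w2]
  exact h c a b

section GaussianIncrements

variable {Ω : Type*} {mΩ : MeasurableSpace Ω} {𝓕 : Filtration ℝ mΩ}

lemma gaussChar_add_left (u v : State d) (r : ℝ) :
    gaussChar (u + v) r =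
      gaussChar u r * gaussChar v r * Complex.exp ((-(r * inner ℝ u v) : ℝ) : ℂ) := by
  rw [gaussChar, gaussChar, gaussChar, ← Complex.exp_add, ← Complex.exp_add, norm_add_sq_real]
  push_cast
  ring_nf

/-- The joint characteristic function of a process with Gaussian increments at the times of `I`
and at a later time `s`: the dependence on the frequency `e` at the time `s` is explicit, and the
remaining factor depends only on the clock `τ`. -/
lemma exists_integral_prod_wave_eq (S : Set ℝ) (τ : ℝ → ℝ) (I : Finset ℝ) (hI : ∀ u ∈ I, u ∈ S)
    (c : ℝ → State d) :
    ∃ k : ℂ, ∀ (P : Measure Ω) (B : ℝ → Ω → State d), HasGaussianIncrements P 𝓕 S τ B →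
      (∀ t ∈ S, ∀ u, ∫ ω, wave u (B t ω) ∂P = gaussChar u (τ t)) →
      ∀ s ∈ S, (∀ u ∈ I, u ≤ s) → ∀ e : State d,
        ∫ ω, (∏ u ∈ I, wave (c u) (B u ω)) * wave e (B s ω) ∂P =
          k * Complex.exp ((-(inner ℝ (∑ u ∈ I, τ u • c u) e) : ℝ) : ℂ) * gaussChar e (τ s) := by
  induction I using Finset.induction_on_max with
  | empty =>
    refine ⟨1, fun P B _ hlaw s hs _ e => ?_⟩
    simp [hlaw s hs e]
  | insert m I hm ih =>
    have hmI : m ∉ I := fun h => lt_irrefl m (hm m h)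
    have hIS : ∀ u ∈ I, u ∈ S := fun u hu => hI u (Finset.mem_insert_of_mem hu)
    have hmS : m ∈ S := hI m (Finset.mem_insert_self m I)
    obtain ⟨k, hk⟩ := ih hIS
    refine ⟨k * Complex.exp ((-(inner ℝ (∑ u ∈ I, τ u • c u) (c m)) : ℝ) : ℂ) *
      gaussChar (c m) (τ m), fun P B hB hlaw s hs hIs e => ?_⟩
    have hms : m ≤ s := hIs m (Finset.mem_insert_self m I)
    -- The increment from the largest time m to s is split off, so the frequency e joins c m at m
    -- and the induction hypothesis applies with m in the role of s.
    have hY : Measurable[𝓕 m] fun ω =>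
        (∏ u ∈ I, wave (c u) (B u ω)) * wave (c m + e) (B m ω) := by
      have hu : ∀ u ∈ I, Measurable[𝓕 m] fun ω => wave (c u) (B u ω) := fun u hu =>
        (measurable_wave (c u)).comp
          ((hB.adapted u (hIS u hu)).mono (𝓕.mono (hm u hu).le) le_rfl)
      exact (Finset.measurable_fun_prod I hu).mul
        ((measurable_wave (c m + e)).comp (hB.adapted m hmS))
    have h1 := hB.integral_mul_wave m hmS s hs hms _ hY (by intro ω; simp) e
    rw [hk P B hB hlaw m hmS (fun u hu => (hm u hu).le) (c m + e)] at h1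
    have h2 : ∀ ω, (∏ u ∈ insert m I, wave (c u) (B u ω)) * wave e (B s ω) =
        (∏ u ∈ I, wave (c u) (B u ω)) * wave (c m + e) (B m ω) *
          wave e (B s ω - B m ω) := by
      intro ω
      have : wave e (B s ω) = wave e (B m ω) * wave e (B s ω - B m ω) := by
        rw [← wave_add]; simp
      rw [Finset.prod_insert hmI, this, wave_add_left]
      ring
    simp_rw [h2]
    rw [h1, Finset.sum_insert hmI, gaussChar_add_left]
    simp only [gaussChar, inner_add_left, inner_add_right, inner_smul_left, mul_assoc,
      ← Complex.exp_add, RCLike.conj_to_real]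
    congr 2
    push_cast
    ring

end GaussianIncrements

end BridgeMixture

/-! ### Sufficiency of the present: the Markov criterion -/

namespace BridgeMixture

open Filter Topology

variable {d : ℕ} {ς : ℝ → ℝ} {T : ℝ≥0}

lemma integral_bind_kernel {α β E : Type*} {mα : MeasurableSpace α} {mβ : MeasurableSpace β}
    [NormedAddCommGroup E] [NormedSpace ℝ E] {ν : Measure α} [SFinite ν] {Q : Kernel α β}
    [IsSFiniteKernel Q] {f : β → E} (hf : Integrable f (ν.bind Q)) :
    ∫ z, f z ∂(ν.bind Q) = ∫ x, ∫ z, f z ∂(Q x) ∂ν := by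
  have h := Measure.comp_eq_comp_const_apply (μ := ν) (κ := Q)
  rw [h] at hf ⊢
  rw [Kernel.integral_comp hf]
  simp

lemma integrable_of_norm_le_one {Ω : Type*} {mΩ : MeasurableSpace Ω} {μ : Measure Ω}
    [IsFiniteMeasure μ] {Y : Ω → ℂ} (hY : Measurable Y) (hY1 : ∀ ω, ‖Y ω‖ ≤ 1) :
    Integrable Y μ :=
  Integrable.of_bound hY.aestronglyMeasurable 1 (ae_of_all _ hY1)

/-- The clock `1 / (β_T - β_t) - κ`. -/
noncomputable def clock (ς : ℝ → ℝ) (T : ℝ≥0) (κ t : ℝ) : ℝ := (remVar ς T t)⁻¹ - κ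

/-- The driving process `(Z_t - x) / (β_T - β_t) + κ x` of the bridge towards `x`. -/
noncomputable def driver (ς : ℝ → ℝ) (T : ℝ≥0) (κ : ℝ) (x : State d) (t : ℝ) (z : Traj d T) :
    State d :=
  scaledGap ς T x z t + κ • x

/-- The part of the rescaled position at the time `u` that is not explained by the position at the
time `s`. -/
noncomputable def innovation (ς : ℝ → ℝ) (T : ℝ≥0) (κ s u : ℝ) (z : Traj d T) : State d :=
  (remVar ς T u)⁻¹ • pos u z -
    (clock ς T κ u / clock ς T κ s) • (remVar ς T s)⁻¹ • pos s z

lemma clock_mono (hς : MemLp ς 2 (volume.restrict (Set.Icc (0 : ℝ) T)))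
    (hpos : ∀ t ∈ Set.Icc (0 : ℝ) T, 0 < ς t) (κ : ℝ) {s t : ℝ} (hs : 0 ≤ s) (hst : s ≤ t)
    (ht : t < T) : clock ς T κ s ≤ clock ς T κ t :=
  sub_le_sub_right (inv_remVar_mono hς hpos hs hst ht) κ

/-- The rescaled position is a driftless process plus the drift x run in the clock; x enters nowhere
else once the law of the driver is free of x. -/
lemma inv_smul_pos_eq (κ : ℝ) (x : State d) (t : ℝ) (z : Traj d T) :
    (remVar ς T t)⁻¹ • pos t z = driver ς T κ x t z + clock ς T κ t • x := by
  rw [driver, clock, scaledGap, smul_sub, sub_smul]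
  abel

lemma pos_eq_driver (hς : MemLp ς 2 (volume.restrict (Set.Icc (0 : ℝ) T)))
    (hpos : ∀ t ∈ Set.Icc (0 : ℝ) T, 0 < ς t) (κ : ℝ) (x : State d) {t : ℝ}
    (ht : t ∈ Set.Ico (0 : ℝ) T) (z : Traj d T) :
    pos t z = remVar ς T t • driver ς T κ x t z + (remVar ς T t * clock ς T κ t) • x := by
  rw [mul_smul, ← smul_add, ← inv_smul_pos_eq, smul_inv_smul₀ (remVar_pos hς hpos ht).ne']

/-- The drift terms cancel, so a function of the trajectory alone is expressed by the driver alone,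
whatever x is. -/
lemma innovation_eq_driver (hς : MemLp ς 2 (volume.restrict (Set.Icc (0 : ℝ) T)))
    (hpos : ∀ t ∈ Set.Icc (0 : ℝ) T, 0 < ς t) {κ : ℝ} (hκ : 0 ≤ clock ς T κ 0) (x : State d)
    {s u : ℝ} (hu : u ∈ Set.Icc 0 s) (hs : s < T) (z : Traj d T) :
    innovation ς T κ s u z = driver ς T κ x u z -
      (clock ς T κ u / clock ς T κ s) • driver ς T κ x s z := by
  have h0 := clock_mono hς hpos κ le_rfl hu.1 (hu.2.trans_lt hs)
  have h1 := clock_mono hς hpos κ hu.1 hu.2 hs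
  have h2 : clock ς T κ u / clock ς T κ s * clock ς T κ s = clock ς T κ u := by
    -- The clock is monotone and nonnegative, so if it vanishes at s it vanishes at u, and division
    -- by zero does no harm. This occurs at s = 0 for v₀ = 0.
    by_cases h : clock ς T κ s = 0
    · rw [h, mul_zero]
      linarith
    · field_simp
  rw [innovation, inv_smul_pos_eq κ x u z, inv_smul_pos_eq κ x s z, smul_add, smul_smul, h2]
  abel

lemma measurable_innovation_past (κ : ℝ) {s u : ℝ} (hu : u ∈ Set.Icc 0 s) :
    Measurable[past d T s] (innovation ς T κ s u) :=
  ((measurable_pos_past hu).const_smul (remVar ς T u)⁻¹).sub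
    (((measurable_pos_past ⟨hu.1.trans hu.2, le_rfl⟩).const_smul (remVar ς T s)⁻¹).const_smul
      (clock ς T κ u / clock ς T κ s))

section Fixed

variable {κ : ℝ} {x : State d} {μ₀ : Measure (State d)} {Q : Measure (Traj d T)}

lemma IsBridgeMeasure.hasGaussianIncrements_driver (hQ : IsBridgeMeasure ς T x μ₀ Q) (κ : ℝ) :
    HasGaussianIncrements Q (pastFiltration d T) (Set.Ico (0 : ℝ) T) (clock ς T κ)
      (driver ς T κ x) where
  adapted t ht := (hQ.increments.adapted t ht).add_const (κ • x)
  integral_mul_wave s hs t ht hst Y hY hY1 u := by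
    have := hQ.increments.integral_mul_wave s hs t ht hst Y hY hY1 u
    simpa [driver, clock] using this

lemma IsBridgeMeasure.integral_wave_driver (hQ : IsBridgeMeasure ς T x μ₀ Q)
    (hinit : ∀ u, ∫ z, wave u (driver ς T κ x 0 z) ∂Q = gaussChar u (clock ς T κ 0)) {t : ℝ}
    (ht : t ∈ Set.Ico (0 : ℝ) T) (u : State d) :
    ∫ z, wave u (driver ς T κ x t z) ∂Q = gaussChar u (clock ς T κ t) := by
  have h0 : (0 : ℝ) ∈ Set.Ico (0 : ℝ) T := ⟨le_rfl, ht.1.trans_lt ht.2⟩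
  have hB := hQ.hasGaussianIncrements_driver κ
  have := hB.integral_mul_wave 0 h0 t ht ht.1 (fun z => wave u (driver ς T κ x 0 z))
    ((measurable_wave u).comp (hB.adapted 0 h0)) (by simp) u
  simpa [← wave_add, ← gaussChar_add, hinit] using this

/-- If t < T, the increment of the driver after s is integrated out; if t = T, the position is the
constant x. The constant and the frequency depend on x but not on Y, which allows a comparison with
Y = 1. -/
lemma IsBridgeMeasure.exists_integral_mul_wave_pos (hQ : IsBridgeMeasure ς T x μ₀ Q)
    (hς : MemLp ς 2 (volume.restrict (Set.Icc (0 : ℝ) T)))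
    (hpos : ∀ t ∈ Set.Icc (0 : ℝ) T, 0 < ς t) (κ : ℝ) {s t : ℝ} (hs : 0 ≤ s) (hst : s ≤ t)
    (hsT : s < T) (ht : t ≤ T) (a b : State d) :
    ∃ (k : ℂ) (e : State d), ∀ Y : Traj d T → ℂ, Measurable[past d T s] Y → (∀ z, ‖Y z‖ ≤ 1) →
      ∫ z, Y z * (wave a (pos s z) * wave b (pos t z)) ∂Q =
        k * ∫ z, Y z * wave e (driver ς T κ x s z) ∂Q := by
  have hB := hQ.hasGaussianIncrements_driver κ
  have hsI : s ∈ Set.Ico (0 : ℝ) T := ⟨hs, hsT⟩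
  rcases ht.eq_or_lt with rfl | htT
  · refine ⟨wave a ((remVar ς T s * clock ς T κ s) • x) * wave b x, remVar ς T s • a,
      fun Y hY hY1 => ?_⟩
    rw [← integral_const_mul]
    refine integral_congr_ae ?_
    filter_upwards [hQ.terminal] with z hz
    rw [hz, pos_eq_driver hς hpos κ x hsI z, wave_add, wave_smul_right _ _ (remVar ς T s)]
    ring
  · have htI : t ∈ Set.Ico (0 : ℝ) T := ⟨hs.trans hst, htT⟩
    refine ⟨wave a ((remVar ς T s * clock ς T κ s) • x) *
      wave b ((remVar ς T t * clock ς T κ t) • x) *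
      gaussChar (remVar ς T t • b) (clock ς T κ t - clock ς T κ s),
      remVar ς T s • a + remVar ς T t • b, fun Y hY hY1 => ?_⟩
    have := hB.integral_mul_wave s hsI t htI hst
      (fun z => Y z * wave (remVar ς T s • a + remVar ς T t • b) (driver ς T κ x s z))
      (hY.mul ((measurable_wave _).comp (hB.adapted s hsI))) (by intro z; simpa using hY1 z)
      (remVar ς T t • b)
    rw [mul_assoc, mul_comm (gaussChar _ _), ← this, ← integral_const_mul]
    refine integral_congr_ae (ae_of_all _ fun z => ?_)
    have e1 : wave (remVar ς T t • b) (driver ς T κ x t z) =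
        wave (remVar ς T t • b) (driver ς T κ x s z) *
          wave (remVar ς T t • b) (driver ς T κ x t z - driver ς T κ x s z) := by
      rw [← wave_add]; simp
    simp only
    rw [pos_eq_driver hς hpos κ x hsI z, pos_eq_driver hς hpos κ x htI z, wave_add, wave_add,
      wave_smul_right _ _ (remVar ς T s), wave_smul_right b _ (remVar ς T t), e1, wave_add_left]
    ring

end Fixed

lemma prod_wave_smul {ι : Type*} (s : Finset ι) (f : ι → State d) (v : State d) :
    ∏ i ∈ s, wave (f i) v = wave (∑ i ∈ s, f i) v := by
  classical
  induction s using Finset.induction_on with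
  | empty => simp
  | insert i s hi ih => rw [Finset.prod_insert hi, Finset.sum_insert hi, wave_add_left, ih]

/-- The innovations before the time `s` are independent of the positions at the times `s` and `t`,
with a law that does not depend on the end point. -/
lemma exists_integral_innovation_mul (hς : MemLp ς 2 (volume.restrict (Set.Icc (0 : ℝ) T)))
    (hpos : ∀ t ∈ Set.Icc (0 : ℝ) T, 0 < ς t) {κ : ℝ} (hκ : 0 ≤ clock ς T κ 0) {s : ℝ}
    (hs : 0 ≤ s) (hsT : s < T) {ι : Type*} [Fintype ι] {θ : ι → ℝ} (hθ : Function.Injective θ)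
    (hθs : ∀ i, θ i ∈ Set.Icc 0 s) (c : ι → State d) :
    ∃ k : ℂ, ∀ (x : State d) (μ₀ : Measure (State d)) (Q : Measure (Traj d T)),
      IsBridgeMeasure ς T x μ₀ Q →
      (∀ u, ∫ z, wave u (driver ς T κ x 0 z) ∂Q = gaussChar u (clock ς T κ 0)) →
      ∀ t, s ≤ t → t ≤ T → ∀ a b : State d,
        ∫ z, (∏ i, wave (c i) (innovation ς T κ s (θ i) z)) *
            (wave a (pos s z) * wave b (pos t z)) ∂Q =
          k * ∫ z, wave a (pos s z) * wave b (pos t z) ∂Q := by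
  have hsI : s ∈ Set.Ico (0 : ℝ) T := ⟨hs, hsT⟩
  have hθI : ∀ i, θ i ∈ Set.Ico (0 : ℝ) T := fun i => ⟨(hθs i).1, (hθs i).2.trans_lt hsT⟩
  set ρ : ι → ℝ := fun i => clock ς T κ (θ i) / clock ς T κ s with hρ
  set w : State d := ∑ i, ρ i • c i with hw
  obtain ⟨k, hk⟩ := exists_integral_prod_wave_eq (𝓕 := pastFiltration d T) (Set.Ico (0 : ℝ) T)
    (clock ς T κ) (Finset.univ.map ⟨θ, hθ⟩) (by simpa using hθI) (Function.extend θ c 0)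
  -- The exponential is what remains after completing the square in `hexp`; it involves neither x
  -- nor a, b, t.
  refine ⟨k * Complex.exp ((clock ς T κ s * ‖w‖ ^ 2 / 2 : ℝ) : ℂ), ?_⟩
  intro x μ₀ Q hQ hinit t hst htT a b
  have hB := hQ.hasGaussianIncrements_driver κ
  have hk' := hk Q (driver ς T κ x) hB (fun t ht u => hQ.integral_wave_driver hinit ht u) s hsI
    (by simpa using fun i => (hθs i).2)
  simp only [Finset.prod_map, Finset.sum_map, Function.Embedding.coeFn_mk,
    hθ.extend_apply] at hk'
  have hsum : ∑ i, clock ς T κ (θ i) • c i = clock ς T κ s • w := by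
    rw [hw, Finset.smul_sum]
    refine Finset.sum_congr rfl fun i _ => ?_
    rw [smul_smul]
    congr 1
    have h0 := clock_mono hς hpos κ le_rfl (hθs i).1 (hθI i).2
    have h1 := clock_mono hς hpos κ (hθs i).1 (hθs i).2 hsT
    by_cases h : clock ς T κ s = 0
    · rw [h, zero_mul]
      linarith
    · simp only [hρ]
      field_simp
  obtain ⟨C, e, hC⟩ := hQ.exists_integral_mul_wave_pos hς hpos κ hs hst hsT htT a b
  have hY : Measurable[past d T s] fun z : Traj d T =>
      ∏ i, wave (c i) (innovation ς T κ s (θ i) z) :=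
    Finset.measurable_fun_prod _ fun i _ =>
      (measurable_wave (c i)).comp (measurable_innovation_past κ (hθs i))
  have hone := hC (fun _ => 1) measurable_const (by simp)
  simp only [one_mul] at hone
  rw [hC _ hY (by simp), hone, hQ.integral_wave_driver hinit hsI]
  have hprod : ∀ z, (∏ i, wave (c i) (innovation ς T κ s (θ i) z)) *
      wave e (driver ς T κ x s z) =
      (∏ i, wave (c i) (driver ς T κ x (θ i) z)) * wave (e - w) (driver ς T κ x s z) := by
    intro z
    have : ∀ i, wave (c i) (innovation ς T κ s (θ i) z) =
        wave (c i) (driver ς T κ x (θ i) z) * wave (-(ρ i • c i)) (driver ς T κ x s z) := by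
      intro i
      rw [innovation_eq_driver hς hpos hκ x (hθs i) hsT, sub_eq_add_neg, wave_add, ← neg_smul,
        wave_smul_right, neg_smul]
    simp_rw [this]
    rw [Finset.prod_mul_distrib, prod_wave_smul, Finset.sum_neg_distrib, ← hw, mul_assoc,
      ← wave_add_left, neg_add_eq_sub]
  simp_rw [hprod]
  rw [hk' (e - w), hsum]
  -- Gaussian orthogonality: the innovations shift the frequency at s to e - w, and the cross term
  -- ⟨w, e⟩ of the shifted Gaussian cancels against that of the joint characteristic function.
  have hexp : Complex.exp ((-(inner ℝ (clock ς T κ s • w) (e - w)) : ℝ) : ℂ) *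
      gaussChar (e - w) (clock ς T κ s) =
      Complex.exp ((clock ς T κ s * ‖w‖ ^ 2 / 2 : ℝ) : ℂ) * gaussChar e (clock ς T κ s) := by
    rw [gaussChar, gaussChar, ← Complex.exp_add, ← Complex.exp_add, real_inner_smul_left,
      inner_sub_right, real_inner_self_eq_norm_sq, norm_sub_sq_real, real_inner_comm e w]
    push_cast
    ring_nf
  linear_combination C * k * hexp

/-- If the driving processes of all bridges have the same law, then the mixture is Markov. -/
lemma isMarkov_bind (hς : MemLp ς 2 (volume.restrict (Set.Icc (0 : ℝ) T)))
    (hpos : ∀ t ∈ Set.Icc (0 : ℝ) T, 0 < ς t) {κ : ℝ} (hκ : 0 ≤ clock ς T κ 0)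
    {ν : Measure (State d)} [IsProbabilityMeasure ν] {Q : Kernel (State d) (Traj d T)}
    {μ₀ : State d → Measure (State d)} (hQ : ∀ x, IsBridgeMeasure ς T x (μ₀ x) (Q x))
    (hinit : ∀ x u, ∫ z, wave u (driver ς T κ x 0 z) ∂(Q x) = gaussChar u (clock ς T κ 0)) :
    IsMarkov (ν.bind Q) := by
  have hQp : IsMarkovKernel Q := ⟨fun x => (hQ x).isProbabilityMeasure⟩
  set M := ν.bind Q with hM
  have hMp : IsProbabilityMeasure M := by rw [hM]; infer_instance
  intro s t hs hst ht S hS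
  have hle := past_le d T s
  have hpp : present d T s ≤ past d T s :=
    (measurable_pos_past (T := T) (d := d) ⟨hs, le_rfl⟩).comap_le
  rcases hst.eq_or_lt with rfl | hlt
  -- For s = t the event already belongs to the present. This also disposes of s = T, where the
  -- rescaling degenerates.
  · have hm : StronglyMeasurable[present d T s]
        ((pos s ⁻¹' S).indicator fun _ : Traj d T => (1 : ℝ)) :=
      StronglyMeasurable.indicator stronglyMeasurable_const ⟨S, hS, rfl⟩
    have hi : Integrable ((pos s ⁻¹' S).indicator fun _ : Traj d T => (1 : ℝ)) M :=
      (integrable_const 1).indicator (measurable_pos s hS)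
    rw [condExp_of_stronglyMeasurable hle (hm.mono hpp) hi,
      condExp_of_stronglyMeasurable (present_le d T s) hm hi]
  have hsT : s < T := hlt.trans_le ht
  have hD : ∀ u : Set.Icc 0 s, Measurable (innovation ς T κ s u : Traj d T → State d) :=
    fun u => (measurable_innovation_past κ u.2).mono hle le_rfl
  have hind : IndepFun (fun z (u : Set.Icc 0 s) => innovation ς T κ s u z)
      (fun z => (pos s z, pos t z)) M := by
    refine IndepFun.process_indepFun hD ((measurable_pos s).prodMk (measurable_pos t))
      fun I => ?_
    refine indepFun_of_integral_wave (fun i => hD i) (measurable_pos s) (measurable_pos t)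
      fun c a b => ?_
    obtain ⟨k, hk⟩ := exists_integral_innovation_mul hς hpos hκ hs hsT (ι := I)
      (θ := fun i => ((i : Set.Icc 0 s) : ℝ))
      (Subtype.val_injective.comp Subtype.val_injective) (fun i => i.1.2) c
    have hmp : ∀ a b : State d, Measurable fun z : Traj d T =>
        wave a (pos s z) * wave b (pos t z) := fun a b =>
      (measurable_wave_comp (measurable_pos s) a).mul (measurable_wave_comp (measurable_pos t) b)
    have hmD : Measurable fun z : Traj d T =>
        ∏ i : I, wave (c i) (innovation ς T κ s (i : Set.Icc 0 s) z) :=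
      Finset.measurable_fun_prod _ fun i _ => measurable_wave_comp (hD i) (c i)
    have key : ∀ a b : State d,
        ∫ z, (∏ i : I, wave (c i) (innovation ς T κ s (i : Set.Icc 0 s) z)) *
            (wave a (pos s z) * wave b (pos t z)) ∂M =
          k * ∫ z, wave a (pos s z) * wave b (pos t z) ∂M := by
      intro a b
      rw [hM, integral_bind_kernel, integral_bind_kernel, ← integral_const_mul]
      · exact integral_congr_ae (ae_of_all _ fun x => hk x _ _ (hQ x) (hinit x) t hst ht a b)
      · exact integrable_of_norm_le_one (hmp a b) (by simp)
      · exact integrable_of_norm_le_one (hmD.mul (hmp a b)) (by simp)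
    -- Zero frequencies identify k as the characteristic function of the innovations under the
    -- mixture.
    have h00 := key 0 0
    simp only [wave_zero_left, mul_one, integral_const, probReal_univ, one_smul] at h00
    rw [key a b, h00]
  have hce := condExp_preimage_sup_eq (measurable_pos s) (measurable_pos t)
    (measurable_pi_iff.2 hD) hind hS
  -- Each past position is recovered from Z_s and its innovation, so the past lies in the σ-algebra
  -- they generate; the tower property then concludes.
  have hsup : past d T s ≤ MeasurableSpace.comap (pos s) inferInstance ⊔
      MeasurableSpace.comap (fun (z : Traj d T) (u : Set.Icc 0 s) => innovation ς T κ s u z)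
        inferInstance := by
    refine iSup₂_le fun u hu => ?_
    refine Measurable.comap_le ?_
    have h1 : Measurable[MeasurableSpace.comap (pos s) inferInstance ⊔ MeasurableSpace.comap
        (fun (z : Traj d T) (u : Set.Icc 0 s) => innovation ς T κ s u z) inferInstance]
        (pos s : Traj d T → State d) :=
      (comap_measurable (pos s)).mono le_sup_left le_rfl
    have h2 : Measurable[MeasurableSpace.comap (pos s) inferInstance ⊔ MeasurableSpace.comap
        (fun (z : Traj d T) (u : Set.Icc 0 s) => innovation ς T κ s u z) inferInstance]
        (innovation ς T κ s u : Traj d T → State d) :=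
      ((measurable_pi_apply (⟨u, hu⟩ : Set.Icc 0 s)).comp (comap_measurable
        (fun (z : Traj d T) (u : Set.Icc 0 s) => innovation ς T κ s u z))).mono le_sup_right le_rfl
    have h3 : (pos u : Traj d T → State d) = fun z => remVar ς T u • (innovation ς T κ s u z +
        (clock ς T κ u / clock ς T κ s) • (remVar ς T s)⁻¹ • pos s z) := by
      ext1 z
      rw [innovation, sub_add_cancel,
        smul_inv_smul₀ (remVar_pos hς hpos ⟨hu.1, hu.2.trans_lt hsT⟩).ne']
    rw [h3]
    exact (h2.add ((h1.const_smul (remVar ς T s)⁻¹).const_smul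
      (clock ς T κ u / clock ς T κ s))).const_smul (remVar ς T u)
  have hsup_le : MeasurableSpace.comap (pos s) inferInstance ⊔
      MeasurableSpace.comap (fun (z : Traj d T) (u : Set.Icc 0 s) => innovation ς T κ s u z)
        inferInstance ≤ instMeasurableSpaceTraj d T :=
    sup_le (measurable_pos s).comap_le (measurable_pi_iff.2 hD).comap_le
  calc M⟦pos t ⁻¹' S | past d T s⟧ =ᵐ[M] M[M⟦pos t ⁻¹' S | _⟧ | past d T s] :=
        (condExp_condExp_of_le hsup hsup_le).symm
    _ =ᵐ[M] M[M⟦pos t ⁻¹' S | present d T s⟧ | past d T s] := condExp_congr_ae hce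
    _ = M⟦pos t ⁻¹' S | present d T s⟧ :=
        condExp_of_stronglyMeasurable hle (stronglyMeasurable_condExp.mono hpp) integrable_condExp

end BridgeMixture

/-! ### The two Markov initializations and the failure of all others -/

namespace BridgeMixture

open Filter Topology

variable {d : ℕ} {ς : ℝ → ℝ} {T : ℝ≥0}

/-- With κ = 1/r_0 the driver starts from Z_0/r_0 = 0, in agreement with a clock that starts from 0.
-/
lemma isMarkov_bind_of_initialLaw_zero
    (hς : MemLp ς 2 (volume.restrict (Set.Icc (0 : ℝ) T)))
    (hpos : ∀ t ∈ Set.Icc (0 : ℝ) T, 0 < ς t)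
    {ν : Measure (State d)} [IsProbabilityMeasure ν] {Q : Kernel (State d) (Traj d T)}
    (hQ : ∀ x, IsBridgeMeasure ς T x (initialLaw ς T 0 x) (Q x)) : IsMarkov (ν.bind Q) := by
  have hclock : clock ς T (remVar ς T 0)⁻¹ 0 = 0 := by simp [clock]
  refine isMarkov_bind hς hpos hclock.ge hQ fun x u => ?_
  have hdr : ∀ z : Traj d T, driver ς T (remVar ς T 0)⁻¹ x 0 z = (remVar ς T 0)⁻¹ • pos 0 z := by
    intro z
    simp [driver, scaledGap, smul_sub]
  have hlaw := (hQ x).init.integral_comp (f := wave ((remVar ς T 0)⁻¹ • u))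
    (continuous_wave _).aestronglyMeasurable
  have h0 : (initialLaw ς T 0 x : Measure (State d)) = isoGaussian 0 0 := by simp [initialLaw]
  rw [h0, integral_wave_isoGaussian 0 le_rfl, gaussChar_zero_right, wave_zero_right] at hlaw
  simp_rw [hdr, wave_smul_right]
  rw [hclock, gaussChar_zero_right]
  simpa [Function.comp_def] using hlaw

/-- With κ = 0 the driver starts from (Z_0 - x)/r_0 ∼ N(0, I/r_0), in agreement with a clock that
starts from 1/r_0. -/
lemma isMarkov_bind_of_initialLaw_top (hT : 0 < T)
    (hς : MemLp ς 2 (volume.restrict (Set.Icc (0 : ℝ) T)))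
    (hpos : ∀ t ∈ Set.Icc (0 : ℝ) T, 0 < ς t)
    {ν : Measure (State d)} [IsProbabilityMeasure ν] {Q : Kernel (State d) (Traj d T)}
    (hQ : ∀ x, IsBridgeMeasure ς T x (initialLaw ς T ∞ x) (Q x)) : IsMarkov (ν.bind Q) := by
  have hr : 0 < remVar ς T 0 := remVar_pos hς hpos ⟨le_rfl, hT⟩
  have hclock : clock ς T 0 0 = (remVar ς T 0)⁻¹ := by simp [clock]
  refine isMarkov_bind hς hpos (κ := 0) (hclock ▸ (inv_pos.2 hr).le) hQ fun x u => ?_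
  have hdr : ∀ z : Traj d T, wave u (driver ς T 0 x 0 z) =
      wave ((remVar ς T 0)⁻¹ • u) (-x) * wave ((remVar ς T 0)⁻¹ • u) (pos 0 z) := by
    intro z
    rw [← wave_add, ← wave_smul_right]
    congr 1
    simp [driver, scaledGap, smul_sub]
    abel
  have hlaw := (hQ x).init.integral_comp (f := wave ((remVar ς T 0)⁻¹ • u))
    (continuous_wave _).aestronglyMeasurable
  have h0 : (initialLaw ς T ∞ x : Measure (State d)) = isoGaussian x (remVar ς T 0) := by
    simp [initialLaw, remVar, accVar]
  rw [h0, integral_wave_isoGaussian x hr.le, gaussChar_smul] at hlaw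
  simp_rw [hdr]
  rw [integral_const_mul]
  simp only [Function.comp_def] at hlaw
  rw [hlaw, ← mul_assoc, ← wave_add, neg_add_cancel, wave_zero_right, one_mul, hclock]
  congr 1
  field_simp

/-- Comparing characteristic functions identifies the Gaussian density, which is positive
everywhere. -/
lemma volume_absolutelyContinuous_isoGaussian {v : ℝ} (hv : 0 < v) :
    (volume : Measure (State d)) ≪ isoGaussian 0 v := by
  set b : ℝ := (2 * v)⁻¹ with hb
  have hb0 : 0 < b := by positivity
  set p : State d → ℝ := fun x => Real.exp (-b * ‖x‖ ^ 2) with hp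
  have hpm : Measurable p := by fun_prop
  have hwave : ∀ u : State d, ∫ x, (p x : ℂ) * wave u x =
      ((Real.pi / b) ^ ((d : ℂ) / 2)) * gaussChar u v := by
    intro u
    have h := GaussianFourier.integral_cexp_neg_mul_sq_norm_add (V := State d) (b := (b : ℂ))
      (by simpa using hb0) Complex.I u
    rw [finrank_euclideanSpace_fin] at h
    convert h using 2
    · ext x
      rw [Complex.exp_add, hp, wave]
      push_cast
      ring_nf
    · rw [gaussChar, hb]
      congr 1
      push_cast
      have : (v : ℂ) ≠ 0 := by exact_mod_cast hv.ne'
      rw [Complex.I_sq]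
      field_simp
      ring
  have hpi : Integrable p := by
    have h := GaussianFourier.integrable_cexp_neg_mul_sq_norm_add (V := State d) (b := (b : ℂ))
      (by simpa using hb0) 0 0
    have h2 := h.re
    refine h2.congr (ae_of_all _ fun x => ?_)
    simp only [hp, zero_mul, add_zero]
    rw [← Complex.ofReal_neg, ← Complex.ofReal_pow, ← Complex.ofReal_mul, ← Complex.ofReal_exp]
    exact Complex.ofReal_re _
  set c : ℝ := ∫ x, p x with hc
  have hcw : (c : ℂ) = ((Real.pi / b) ^ ((d : ℂ) / 2)) := by
    have := hwave 0
    simp only [wave_zero_left, mul_one, gaussChar_zero_left] at this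
    rw [← this, hc, integral_complex_ofReal]
  have hc0 : 0 < c := by
    rw [hc, integral_pos_iff_support_of_nonneg (fun x => (Real.exp_pos _).le) hpi]
    have : Function.support p = Set.univ := by
      ext x; simp [hp, Real.exp_ne_zero]
    rw [this]
    exact Measure.measure_univ_pos.2 (NeZero.ne _)
  set q : State d → ℝ := fun x => c⁻¹ * p x with hq
  have hqm : Measurable q := hpm.const_mul _
  have hq0 : ∀ x, 0 < q x := fun x => mul_pos (inv_pos.2 hc0) (Real.exp_pos _)
  have hqi : Integrable q := hpi.const_mul _
  have hfin : IsFiniteMeasure (volume.withDensity fun x : State d => ENNReal.ofReal (q x)) :=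
    isFiniteMeasure_withDensity_ofReal hqi.2
  have heq : isoGaussian 0 v = volume.withDensity fun x : State d => ENNReal.ofReal (q x) := by
    refine ext_of_integral_wave fun u => ?_
    rw [integral_wave_isoGaussian 0 hv.le, wave_zero_right, one_mul,
      integral_withDensity_eq_integral_toReal_smul hqm.ennreal_ofReal (ae_of_all _ fun x => by simp)]
    have e : ∀ x, (ENNReal.ofReal (q x)).toReal • wave u x = (c : ℂ)⁻¹ * ((p x : ℂ) * wave u x) := by
      intro x
      rw [ENNReal.toReal_ofReal (hq0 x).le, Complex.real_smul, hq]
      push_cast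
      ring
    simp_rw [e]
    rw [integral_const_mul, hwave u, ← hcw, inv_mul_cancel_left₀ (by exact_mod_cast hc0.ne')]
  rw [heq]
  exact withDensity_absolutelyContinuous' hqm.ennreal_ofReal.aemeasurable
    (ae_of_all _ fun x => by simpa using hq0 x)

/-- If `W` is independent of `(X, Y)` and the Lebesgue measure is absolutely continuous with
respect to its law, then `Y` can be predicted from `X + W` as well as from `(X, W)`
only if `Y` is independent of `X`. -/
lemma indepFun_of_condExp_preimage_sup_eq {Ω B : Type*} {mΩ : MeasurableSpace Ω}
    [MeasurableSpace B] {μ : Measure Ω} [IsProbabilityMeasure μ] {X W : Ω → State d} {Y : Ω → B}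
    (hX : Measurable X) (hY : Measurable Y) (hW : Measurable W)
    (h : IndepFun W (fun ω => (X ω, Y ω)) μ) (hac : volume ≪ μ.map W)
    (hce : ∀ S : Set B, MeasurableSet S →
      μ⟦Y ⁻¹' S | MeasurableSpace.comap X inferInstance ⊔ MeasurableSpace.comap W inferInstance⟧
        =ᵐ[μ] μ⟦Y ⁻¹' S | MeasurableSpace.comap (fun ω => X ω + W ω) inferInstance⟧) :
    IndepFun X Y μ := by
  rw [indepFun_iff_measure_inter_preimage_eq_mul]
  intro C S hC hS
  have hfi : Integrable ((Y ⁻¹' S).indicator fun _ => (1 : ℝ)) μ :=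
    (integrable_const 1).indicator (hY hS)
  obtain ⟨f, hf, hfX⟩ : ∃ f : State d → ℝ, StronglyMeasurable f ∧
      μ⟦Y ⁻¹' S | MeasurableSpace.comap X inferInstance⟧ = f ∘ X :=
    stronglyMeasurable_condExp.exists_eq_measurable_comp
  obtain ⟨g, hg, hgV⟩ : ∃ g : State d → ℝ, StronglyMeasurable g ∧
      μ⟦Y ⁻¹' S | MeasurableSpace.comap (fun ω => X ω + W ω) inferInstance⟧ =
        g ∘ fun ω => X ω + W ω :=
    stronglyMeasurable_condExp.exists_eq_measurable_comp
  have hfg : ∀ᵐ ω ∂μ, f (X ω) = g (X ω + W ω) := by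
    filter_upwards [hce S hS, condExp_preimage_sup_eq hX hY hW h hS] with ω h1 h2
    rw [h1, hfX, hgV] at h2
    exact h2.symm
  have hρ := Measure.isProbabilityMeasure_map (μ := μ) hX.aemeasurable
  have hγ := Measure.isProbabilityMeasure_map (μ := μ) hW.aemeasurable
  have hXW : IndepFun X W μ := (h.comp measurable_id measurable_fst).symm
  have hprod := (indepFun_iff_map_prod_eq_prod_map_map hX.aemeasurable hW.aemeasurable).1 hXW
  have hae : ∀ᵐ p ∂(μ.map X).prod (μ.map W), f p.1 = g (p.1 + p.2) := by
    rw [← hprod, ae_map_iff (hX.prodMk hW).aemeasurable]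
    · exact hfg
    · exact measurableSet_eq_fun (hf.measurable.comp measurable_fst)
        (hg.measurable.comp (measurable_fst.add measurable_snd))
  -- For almost every r, f r = g (r + w) for Lebesgue-almost every w, so by translation invariance g
  -- equals f r almost everywhere. Two such values of r share a point y, hence f is almost surely
  -- constant.
  have hae' : ∀ᵐ r ∂(μ.map X), ∀ᵐ y : State d, f r = g y := by
    filter_upwards [Measure.ae_ae_of_ae_prod hae] with r hr
    have h1 : ∀ᵐ w : State d, f r = g (r + w) := hac.ae_le hr
    have h2 := (measurePreserving_sub_right (volume : Measure (State d)) r).quasiMeasurePreserving.ae h1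
    filter_upwards [h2] with y hy
    simpa using hy
  obtain ⟨r₀, hr₀⟩ := hae'.exists
  have hconst : ∀ᵐ ω ∂μ, f (X ω) = f r₀ := by
    refine ae_of_ae_map (p := fun r => f r = f r₀) hX.aemeasurable ?_
    filter_upwards [hae'] with r hr
    obtain ⟨y, h1, h2⟩ := (hr.and hr₀).exists
    exact h1.trans h2.symm
  have key : ∀ C : Set (State d), MeasurableSet C →
      μ.real (X ⁻¹' C ∩ Y ⁻¹' S) = f r₀ * μ.real (X ⁻¹' C) := by
    intro C hC
    have h1 := setIntegral_condExp hX.comap_le hfi ⟨C, hC, rfl⟩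
    rw [hfX, setIntegral_indicator (hY hS), setIntegral_const,
      setIntegral_congr_ae (g := fun _ => f r₀) (hX hC)
        (by filter_upwards [hconst] with ω hω _ using hω), setIntegral_const] at h1
    simpa [mul_comm] using h1.symm
  have h1 := key Set.univ MeasurableSet.univ
  simp only [Set.preimage_univ, Set.univ_inter, probReal_univ, mul_one] at h1
  have h2 := key C hC
  rw [← h1] at h2
  rw [← ENNReal.toReal_eq_toReal_iff' (by finiteness) (by finiteness), ENNReal.toReal_mul, mul_comm]
  exact h2

/-- Multiplicativity of the characteristic function says that the identity is independent of itself,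
so every event has probability 0 or 1. -/
lemma exists_eq_dirac_of_integral_wave_add {ν : Measure (State d)} [IsProbabilityMeasure ν]
    (h : ∀ u w : State d, ∫ x, wave (u + w) x ∂ν = (∫ x, wave u x ∂ν) * ∫ x, wave w x ∂ν) :
    ∃ a, ν = Measure.dirac a := by
  have hind : IndepFun (fun x (_ : Unit) => x) (fun x : State d => (x, (0 : State d))) ν := by
    refine indepFun_of_integral_wave (fun _ => measurable_id) measurable_id measurable_const
      fun c a b => ?_
    simpa [wave_add_left] using h (c ()) a
  have hself : IndepFun (id : State d → State d) id ν :=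
    hind.comp (measurable_pi_apply ()) measurable_fst
  have : IsZeroOneMeasure ν := by
    refine ⟨fun s hs => ?_⟩
    refine measure_eq_zero_or_one_of_indep_self hself ?_
    exact ⟨s, hs, rfl⟩
  exact IsZeroOneMeasure.exists_eq_dirac

/-- The characteristic function of the terminal position, of the position at the time `s` after
removing its linear dependence on the initial position, and of the initial position. -/
lemma IsBridgeMeasure.integral_wave_residual {x : State d} {v : ℝ} {Q : Measure (Traj d T)}
    (hQ : IsBridgeMeasure ς T x (isoGaussian 0 v) Q) (hv : 0 ≤ v)
    (hς : MemLp ς 2 (volume.restrict (Set.Icc (0 : ℝ) T)))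
    (hpos : ∀ t ∈ Set.Icc (0 : ℝ) T, 0 < ς t) {s : ℝ} (hs : s ∈ Set.Ico (0 : ℝ) T) (c : ℝ)
    (hc : c = remVar ς T s / remVar ς T 0) (w u e : State d) :
    ∫ z, wave w (c • pos 0 z) * (wave u (pos s z - c • pos 0 z) * wave e (pos T z)) ∂Q =
      gaussChar w (c ^ 2 * v) * gaussChar u (remVar ς T s * (1 - c)) * wave ((1 - c) • u + e) x := by
  have hQp := hQ.isProbabilityMeasure
  have hs0 := remVar_pos hς hpos hs
  have h0 : (0 : ℝ) ∈ Set.Ico (0 : ℝ) T := ⟨le_rfl, hs.1.trans_lt hs.2⟩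
  have h00 := remVar_pos hς hpos h0
  have hincr := hQ.increments.integral_mul_wave 0 h0 s hs hs.1
    (fun z => wave (c • w) (pos 0 z))
    ((measurable_wave _).comp (measurable_pos_past ⟨le_rfl, le_rfl⟩)) (by simp)
    (remVar ς T s • u)
  have hlaw := hQ.init.integral_comp (f := wave (c • w)) (continuous_wave _).aestronglyMeasurable
  simp only [Function.comp_def] at hlaw
  rw [hlaw, integral_wave_isoGaussian 0 hv, wave_zero_right, one_mul, gaussChar_smul,
    gaussChar_smul] at hincr
  have hae : ∀ᵐ z ∂Q, wave w (c • pos 0 z) * (wave u (pos s z - c • pos 0 z) * wave e (pos T z)) =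
      wave ((1 - c) • u + e) x * (wave (c • w) (pos 0 z) *
        wave (remVar ς T s • u) (scaledGap ς T x z s - scaledGap ς T x z 0)) := by
    filter_upwards [hQ.terminal] with z hz
    -- The choice c = r_s/r_0 makes the initial position cancel, leaving (1 - c) x and an increment
    -- of G.
    have e1 : pos s z - c • pos 0 z =
        (1 - c) • x + remVar ς T s • (scaledGap ς T x z s - scaledGap ς T x z 0) := by
      rw [scaledGap, scaledGap, smul_sub, smul_inv_smul₀ hs0.ne', smul_smul, ← div_eq_mul_inv, ← hc]
      module
    rw [hz, e1, wave_add, wave_smul_right, wave_smul_right, wave_smul_right, wave_add_left]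
    ring
  rw [integral_congr_ae hae, integral_const_mul, hincr]
  have : remVar ς T s ^ 2 * ((remVar ς T s)⁻¹ - (remVar ς T 0)⁻¹) = remVar ς T s * (1 - c) := by
    rw [hc]; field_simp
  rw [this]
  ring

lemma not_isMarkov_bind (hT : 0 < T)
    (hς : MemLp ς 2 (volume.restrict (Set.Icc (0 : ℝ) T)))
    (hpos : ∀ t ∈ Set.Icc (0 : ℝ) T, 0 < ς t) {v : ℝ} (hv : 0 < v)
    {ν : Measure (State d)} [IsProbabilityMeasure ν] (hν : ∀ a : State d, ν ≠ Measure.dirac a)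
    {Q : Kernel (State d) (Traj d T)}
    (hQ : ∀ x, IsBridgeMeasure ς T x (isoGaussian 0 v) (Q x)) : ¬ IsMarkov (ν.bind Q) := by
  intro hM
  have hQp : IsMarkovKernel Q := ⟨fun x => (hQ x).isProbabilityMeasure⟩
  have hT' : (0 : ℝ) < T := hT
  obtain ⟨s, hs0, hsT⟩ := exists_between hT'
  have hs : s ∈ Set.Ico (0 : ℝ) T := ⟨hs0.le, hsT⟩
  set c : ℝ := remVar ς T s / remVar ς T 0 with hc
  have hrs := remVar_pos hς hpos hs
  have hr0 : 0 < remVar ς T 0 := remVar_pos hς hpos ⟨le_rfl, hT'⟩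
  have hc0 : 0 < c := div_pos hrs hr0
  have hc1 : c < 1 := by
    rw [hc, div_lt_one hr0]
    exact sub_lt_sub_left (accVar_lt hς hpos le_rfl hs0 hsT.le) _
  have hPM : IsProbabilityMeasure (ν.bind Q) := inferInstance
  set W : Traj d T → State d := fun z => c • pos 0 z with hW
  set R : Traj d T → State d := fun z => pos s z - c • pos 0 z with hR
  have hWm : Measurable W := (measurable_pos 0).const_smul c
  have hRm : Measurable R := (measurable_pos s).sub hWm
  have hTm : Measurable (pos T : Traj d T → State d) := measurable_pos T
  have key : ∀ w u e : State d,
      ∫ z, wave w (W z) * (wave u (R z) * wave e (pos T z)) ∂(ν.bind Q) =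
        gaussChar w (c ^ 2 * v) * gaussChar u (remVar ς T s * (1 - c)) *
          ∫ x, wave ((1 - c) • u + e) x ∂ν := by
    intro w u e
    rw [integral_bind_kernel, ← integral_const_mul]
    · exact integral_congr_ae (ae_of_all _ fun x =>
        (hQ x).integral_wave_residual hv.le hς hpos hs c hc w u e)
    · exact integrable_of_norm_le_one ((measurable_wave_comp hWm w).mul
        ((measurable_wave_comp hRm u).mul (measurable_wave_comp hTm e))) (by simp)
  have keyW : ∀ w, ∫ z, wave w (W z) ∂(ν.bind Q) = gaussChar w (c ^ 2 * v) := by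
    intro w
    simpa using key w 0 0
  have keyR : ∀ u e, ∫ z, wave u (R z) * wave e (pos T z) ∂(ν.bind Q) =
      gaussChar u (remVar ς T s * (1 - c)) * ∫ x, wave ((1 - c) • u + e) x ∂ν := by
    intro u e
    simpa using key 0 u e
  have hind : IndepFun W (fun z => (R z, pos T z)) (ν.bind Q) := by
    have h : IndepFun (fun z (_ : Unit) => W z) (fun z => (R z, pos T z)) (ν.bind Q) := by
      refine indepFun_of_integral_wave (fun _ => hWm) hRm hTm fun w u e => ?_
      simp only [Finset.univ_unique, Finset.prod_singleton]
      rw [key, keyW, keyR, mul_assoc]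
    exact h.comp (measurable_pi_apply ()) measurable_id
  have hlawW : (ν.bind Q).map W = isoGaussian 0 (c ^ 2 * v) := by
    have := Measure.isProbabilityMeasure_map (μ := ν.bind Q) hWm.aemeasurable
    refine ext_of_integral_wave fun w => ?_
    rw [integral_map hWm.aemeasurable (continuous_wave w).aestronglyMeasurable, keyW,
      integral_wave_isoGaussian 0 (by positivity), wave_zero_right, one_mul]
  have hadd : (fun z => R z + W z) = (pos s : Traj d T → State d) := by
    ext1 z; simp [hR, hW]
  have hRT : IndepFun R (pos T) (ν.bind Q) := by
    refine indepFun_of_condExp_preimage_sup_eq hRm hTm hWm hind ?_ fun S hS => ?_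
    · rw [hlawW]
      exact volume_absolutelyContinuous_isoGaussian (by positivity)
    rw [hadd]
    have hp0 := measurable_pos_past (T := T) (d := d) (u := 0) (s := s) ⟨le_rfl, hs.1⟩
    have hps := measurable_pos_past (T := T) (d := d) (u := s) (s := s) ⟨hs.1, le_rfl⟩
    have hsup_past : MeasurableSpace.comap R inferInstance ⊔
        MeasurableSpace.comap W inferInstance ≤ past d T s :=
      sup_le (hps.sub (hp0.const_smul c)).comap_le (hp0.const_smul c).comap_le
    have hpres : present d T s ≤ MeasurableSpace.comap R inferInstance ⊔
        MeasurableSpace.comap W inferInstance := by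
      refine Measurable.comap_le ?_
      rw [← hadd]
      exact ((comap_measurable R).mono le_sup_left le_rfl).add
        ((comap_measurable W).mono le_sup_right le_rfl)
    -- The σ-algebra of (R, W) lies between the present and the past, so the Markov property passes
    -- to it by the tower property.
    calc (ν.bind Q)⟦pos T ⁻¹' S | _⟧
        =ᵐ[ν.bind Q] (ν.bind Q)[(ν.bind Q)⟦pos T ⁻¹' S | past d T s⟧ | _] :=
          (condExp_condExp_of_le hsup_past (past_le d T s)).symm
      _ =ᵐ[ν.bind Q] (ν.bind Q)[(ν.bind Q)⟦pos T ⁻¹' S | present d T s⟧ | _] :=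
          condExp_congr_ae (hM s T hs.1 hsT.le le_rfl S hS)
      _ = (ν.bind Q)⟦pos T ⁻¹' S | present d T s⟧ :=
          condExp_of_stronglyMeasurable (hsup_past.trans (past_le d T s))
            (stronglyMeasurable_condExp.mono hpres) integrable_condExp
  obtain ⟨a, ha⟩ : ∃ a, ν = Measure.dirac a := by
    refine exists_eq_dirac_of_integral_wave_add fun u e => ?_
    have hc1' : 1 - c ≠ 0 := (sub_pos.2 hc1).ne'
    -- The frequency is divided by 1 - c so that R contributes ⟨u, x⟩; the Gaussian factor of the
    -- noise then appears on both sides and cancels.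
    have h := hRT.integral_fun_comp_mul_comp (f := wave ((1 - c)⁻¹ • u)) (g := wave e)
      hRm.aemeasurable hTm.aemeasurable (continuous_wave _).aestronglyMeasurable
      (continuous_wave _).aestronglyMeasurable
    have hR1 := keyR ((1 - c)⁻¹ • u) 0
    have hT1 := keyR 0 e
    simp only [wave_zero_left, mul_one, one_mul, gaussChar_zero_left, smul_zero, zero_add,
      add_zero, smul_inv_smul₀ hc1'] at hR1 hT1
    rw [keyR, hR1, hT1, smul_inv_smul₀ hc1', mul_assoc] at h
    exact mul_left_cancel₀ (gaussChar_ne_zero _ _) h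
  exact hν a ha

end BridgeMixture

theorem proposition3 {d : ℕ} (T : ℝ≥0) (hT : 0 < T) (ς : ℝ → ℝ)
    (hς : MemLp ς 2 (volume.restrict (Set.Icc (0 : ℝ) T)))
    (hς_pos : ∀ t ∈ Set.Icc (0 : ℝ) T, 0 < ς t)
    (v₀ : ℝ≥0∞)
    (ν : Measure (State d)) [IsProbabilityMeasure ν] (hν : ∀ a : State d, ν ≠ Measure.dirac a)
    (Q : Kernel (State d) (Traj d T))
    (hQ : ∀ x : State d, IsBridgeLaw ς T x (initialLaw ς T v₀ x) (Q x)) :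
    IsMarkov (ν.bind Q) ↔ v₀ = 0 ∨ v₀ = ∞ := by
  have hB := fun x => (hQ x).isBridgeMeasure hT hς hς_pos
  constructor
  · intro hM
    by_contra! hv
    refine not_isMarkov_bind hT hς hς_pos (ENNReal.toReal_pos hv.1 hv.2) hν (fun x => ?_) hM
    simpa [initialLaw, hv.2] using hB x
  · rintro (rfl | rfl)
    · exact isMarkov_bind_of_initialLaw_zero hς hς_pos hB
    · exact isMarkov_bind_of_initialLaw_top hT hς hς_pos hB
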